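/- **Definitions.** All complexes are \emph{simplicial regular CW-complexes}: finite regular CW-complexes in which, for every face $F$, the interval $[\emptyset,F]$ of the face poset is Boolean (they are determined by their face posets). The empty set is a face of dimension $-1$. Two distinct faces may have the same vertices; if this never happens, the complex is a \emph{simplicial complex}. Let $d,t$ be integers with $1\le t\le d$. A \emph{$d$-pseudomanifold} is a complex that is pure of dimension $d$ and in which every $(d-1)$-face lies in at most two $d$-faces (it may be disconnected). A \emph{boundary $(d-1)$-face} is one that lies in exactly one $d$-face. A \emph{tree of $d$-simplices} is a triangulated $d$-ball whose dual graph is a tree, i.e. a complex obtained from a $d$-simplex by repeatedly attaching a new $d$-simplex along exactly one boundary $(d-1)$-face. A $d$-pseudomanifold is \emph{$t$-LC} if it can be obtained from a tree of $d$-simplices by recursively identifying two distinct boundary $(d-1)$-faces whose intersection in the current complex has dimension at least $d-1-t$ (each intermediate complex being again a simplicial regular CW-complex). \emph{Constructible} complexes are defined recursively: every simplex and every (nonempty) $0$-dimensional complex is constructible; a $d$-dimensional complex ($d\ge 1$) that is not a simplex is constructible if and only if it is a union $C_1\cup C_2$ of two constructible $d$-dimensional subcomplexes such that $C_1\cap C_2$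 is a constructible $(d-1)$-dimensional complex. \emph{$t$-constructible} $d$-dimensional complexes are defined recursively: every $d$-simplex is $t$-constructible; for $d=1$, a $1$-dimensional complex is $t$-constructible if and only if it is connected; a pure $d$-dimensional complex that is not a simplex is $t$-constructible if and only if it is a union $C_1\cup C_2$ of two $t$-constructible $d$-dimensional subcomplexes such that $C_1\cap C_2$ is a pure $(d-1)$-dimensional complex whose $(d-t)$-skeleton is constructible. **Proposition.** Let $1\le t\le d$ be integers. For $d$-pseudomanifolds we have $$\{t\text{-constructible}\}\;\subseteq\;\{t\text{-LC}\}\;\subseteq\;\{\text{all}\},$$ that is, every $t$-constructible $d$-pseudomanifold is $t$-LC, and $t$-LC $d$-pseudomanifolds are $d$-pseudomanifolds. If $d\ge t+2$, both inclusions are strict: there is a $t$-LC $d$-pseudomanifold that is not $t$-constructible, and there is a $d$-pseudomanifold that is not $t$-LC; in both cases the example can be chosen to be a simplicial complex. -/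

import Mathlib

/-- A simplicial regular CW-complex, presented by its face poset (which determines a regular
CW-complex up to homeomorphism): a finite poset with a least element (the empty face) in which
every interval `[⊥, F]` is Boolean.  Conversely every such poset is the face poset of a
simplicial regular CW-complex. -/
structure SimplicialCW where
  Face : Type
  [partialOrder : PartialOrder Face]
  [orderBot : OrderBot Face]
  [finite : Finite Face]
  boolean : ∀ F : Face, ∃ k : ℕ, Nonempty (Set.Iic F ≃o Finset (Fin k))

attribute [instance] SimplicialCW.partialOrder SimplicialCW.orderBot SimplicialCW.finite

namespace SimplicialCW

/-- The dimension of a face: its number of vertices minus one; the empty face has dimension `-1`. -/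
noncomputable def dim (K : SimplicialCW) (F : K.Face) : ℤ :=
  ({v : K.Face | IsAtom v ∧ v ≤ F}.ncard : ℤ) - 1

theorem dim_mono (K : SimplicialCW) {F G : K.Face} (h : F ≤ G) : K.dim F ≤ K.dim G := by
  have : {v : K.Face | IsAtom v ∧ v ≤ F}.ncard ≤ {v : K.Face | IsAtom v ∧ v ≤ G}.ncard :=
    Set.ncard_le_ncard (fun v hv => ⟨hv.1, hv.2.trans h⟩) (Set.toFinite _)
  unfold dim
  omega

/-- `K` is a simplicial complex: a face is determined by its set of vertices. -/
def IsSimplicialComplex (K : SimplicialCW) : Prop :=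
  ∀ F G : K.Face, (∀ v, IsAtom v → (v ≤ F ↔ v ≤ G)) → F = G

/-! Subcomplexes of `K` are the lower sets of its face poset that contain the empty face. -/

/-- The subcomplex `C` is nonvoid and pure of dimension `d`: all its facets have dimension `d`. -/
def IsPure (K : SimplicialCW) (d : ℤ) (C : LowerSet K.Face) : Prop :=
  ⊥ ∈ C ∧ ∀ F, Maximal (· ∈ C) F → K.dim F = d

/-- The `k`-skeleton of a subcomplex. -/
def skeleton (K : SimplicialCW) (k : ℤ) (C : LowerSet K.Face) : LowerSet K.Face where
  carrier := {F | F ∈ C ∧ K.dim F ≤ k}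
  lower' := fun _ _ hba ha => ⟨C.lower hba ha.1, (K.dim_mono hba).trans ha.2⟩

/-- The subcomplex `C` is connected: any two vertices are joined by a path of edges of `C`. -/
def IsConnectedComplex (K : SimplicialCW) (C : LowerSet K.Face) : Prop :=
  ∀ v w : K.Face, IsAtom v → v ∈ C → IsAtom w → w ∈ C →
    Relation.ReflTransGen
      (fun a b => IsAtom a ∧ IsAtom b ∧ ∃ e ∈ C, K.dim e = 1 ∧ a ≤ e ∧ b ≤ e) v w

/-- Constructible `d`-dimensional subcomplexes: simplices, `0`-complexes, and unions of two
constructible `d`-complexes whose intersection is a constructible `(d-1)`-complex. -/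
inductive IsConstructible (K : SimplicialCW) : ℕ → LowerSet K.Face → Prop
  | simplex (d : ℕ) (F : K.Face) (hF : K.dim F = d) : IsConstructible K d (LowerSet.Iic F)
  | zero (C : LowerSet K.Face) (hC : K.IsPure 0 C) : IsConstructible K 0 C
  | union (d : ℕ) (C₁ C₂ : LowerSet K.Face)
      (h₁ : IsConstructible K (d + 1) C₁) (h₂ : IsConstructible K (d + 1) C₂)
      (h : IsConstructible K d (C₁ ⊓ C₂)) : IsConstructible K (d + 1) (C₁ ⊔ C₂)

/-- `t`-constructible `d`-dimensional subcomplexes: simplices, connected `1`-complexes (if `d = 1`),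
and unions of two `t`-constructible `d`-complexes whose intersection is a pure `(d-1)`-complex
with constructible `(d-t)`-skeleton. -/
inductive IsTConstructibleSub (K : SimplicialCW) (d t : ℕ) : LowerSet K.Face → Prop
  | simplex (F : K.Face) (hF : K.dim F = d) : IsTConstructibleSub K d t (LowerSet.Iic F)
  | connected (C : LowerSet K.Face) (hd : d = 1) (hC : K.IsPure 1 C)
      (hconn : K.IsConnectedComplex C) : IsTConstructibleSub K d t C
  | union (C₁ C₂ : LowerSet K.Face) (k : ℕ) (hk : k + t = d)
      (h₁ : IsTConstructibleSub K d t C₁) (h₂ : IsTConstructibleSub K d t C₂)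
      (hpure : K.IsPure ((d : ℤ) - 1) (C₁ ⊓ C₂))
      (hskel : K.IsConstructible k (K.skeleton k (C₁ ⊓ C₂))) :
      IsTConstructibleSub K d t (C₁ ⊔ C₂)

/-- `K` is a `t`-constructible `d`-dimensional complex. -/
def IsTConstructible (K : SimplicialCW) (d t : ℕ) : Prop :=
  K.IsTConstructibleSub d t ⊤

/-- `K` is a `d`-pseudomanifold: it is pure of dimension `d` and every `(d-1)`-face lies in at most
two `d`-faces. -/
def IsPseudomanifold (K : SimplicialCW) (d : ℕ) : Prop :=
  K.IsPure d ⊤ ∧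
    ∀ σ : K.Face, K.dim σ = (d : ℤ) - 1 → {F : K.Face | K.dim F = d ∧ σ ≤ F}.ncard ≤ 2

/-- `σ` is a boundary `(d-1)`-face of the subcomplex `C`: it lies in exactly one `d`-face of `C`. -/
def IsBoundaryFacet (K : SimplicialCW) (d : ℕ) (C : LowerSet K.Face) (σ : K.Face) : Prop :=
  K.dim σ = (d : ℤ) - 1 ∧ ∃! F : K.Face, F ∈ C ∧ K.dim F = d ∧ σ ≤ F

/-- Trees of `d`-simplices: obtained from one `d`-simplex by successively attaching a new
`d`-simplex along exactly one `(d-1)`-face of the current boundary (so the vertex opposite to that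
face is new).  These are the triangulated `d`-balls whose dual graph is a tree. -/
inductive IsTreeSub (K : SimplicialCW) (d : ℕ) : LowerSet K.Face → Prop
  | simplex (F : K.Face) (hF : K.dim F = d) : IsTreeSub K d (LowerSet.Iic F)
  | attach (C : LowerSet K.Face) (σ F : K.Face) (hC : IsTreeSub K d C)
      (hσ : K.IsBoundaryFacet d C σ) (hF : K.dim F = d)
      (hint : C ⊓ LowerSet.Iic F = LowerSet.Iic σ) : IsTreeSub K d (C ⊔ LowerSet.Iic F)

/-- `K` is a tree of `d`-simplices. -/
def IsTreeOfSimplices (K : SimplicialCW) (d : ℕ) : Prop :=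
  K.IsTreeSub d ⊤

/-- `Q` is obtained from `P` by a `t`-LC gluing: two distinct boundary `(d-1)`-faces `Δ`, `Δ'` whose
intersection has dimension at least `d-1-t` are identified along an isomorphism `φ`.  The map `π`
is the quotient map and `Q` carries the quotient order.  That `Q` is again a `SimplicialCW` says
that the gluing identifies no two faces of one simplex, i.e. the result is a regular complex. -/
def IsTLCGluing (d t : ℕ) (P Q : SimplicialCW) : Prop :=
  ∃ Δ Δ' : P.Face, Δ ≠ Δ' ∧ P.IsBoundaryFacet d ⊤ Δ ∧ P.IsBoundaryFacet d ⊤ Δ' ∧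
    (∃ τ : P.Face, τ ≤ Δ ∧ τ ≤ Δ' ∧ (d : ℤ) - 1 - t ≤ P.dim τ) ∧
    ∃ (φ : Set.Iic Δ ≃o Set.Iic Δ') (π : P.Face → Q.Face),
      Function.Surjective π ∧
      (∀ x y, π x = π y ↔
        Relation.EqvGen (fun a b => ∃ h : a ≤ Δ, (φ ⟨a, h⟩ : P.Face) = b) x y) ∧
      (∀ x y, π x ≤ π y ↔ ∃ x' y', π x' = π x ∧ π y' = π y ∧ x' ≤ y')

/-- `M` admits a `t`-local construction: it is obtained from some tree of `d`-simplices by a finite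
sequence of `t`-LC gluings. -/
def HasTLocalConstruction (M : SimplicialCW) (d t : ℕ) : Prop :=
  ∃ T : SimplicialCW, T.IsTreeOfSimplices d ∧ Relation.ReflTransGen (IsTLCGluing d t) T M

/-- `M` is a `t`-LC `d`-pseudomanifold. -/
def IsTLC (M : SimplicialCW) (d t : ℕ) : Prop :=
  M.IsPseudomanifold d ∧ M.HasTLocalConstruction d t

end SimplicialCW

/-!
The plan is to reduce local constructions to orderings of ridges inside one fixed complex.

For a pseudomanifold `K` and a set `E` of its ridges, let `K.cut d E` be the complex obtained from
the disjoint union of the facets of `K` by gluing only along the ridges in `E`.  Its faces are the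
pairs of a face `G` of `K` and a component of the star of `G` in which neighbours share a ridge from
`E`.  If the ridges in `E` form a spanning tree of the dual graph, `K.cut d E` is a tree of
simplices (`IsDualTree.isTreeOfSimplices`); adding to `E` a ridge whose two facets already lie in
one component of the star of a face of dimension at least `d - 1 - t` is a `t`-LC gluing
(`isTLCGluing_cut`); and if the stars of all faces are connected through `E`, then `K.cut d E` is
`K` again (`cutIso`).

`IsWeaklyConstructible` weakens `t`-constructibility: the intersection of the two pieces has to be
pure of dimension `d - 1`, and its ridges have to be joined to each other through faces of dimension
at least `d - 1 - t`.  This holds when the `(d - t)`-skeleton of the intersection is constructible,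
because constructible complexes are strongly connected.  In a weakly constructible pseudomanifold,
spanning trees of the two pieces are joined across one common ridge, and the remaining common ridges
are added by walking through the intersection.  So weakly constructible pseudomanifolds are `t`-LC
(`IsWeaklyConstructible.isTLC`), which gives the first inclusion.

The first inclusion is strict because weak constructibility permits cohomology.  By Mayer–Vietoris,
the reduced cohomology modulo 2 of a `t`-constructible complex vanishes up to degree `d - t`
(`IsTConstructibleSub.isAcyclicAt`), in particular in degree `2` if `t + 2 ≤ d`.  The iterated prism
over the boundary of a tetrahedron, a triangulation of the product of a `2`-sphere and a
`(d - 2)`-ball, is a weakly constructible pseudomanifold for every `t ≥ 1`, but has nonzero second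
cohomology (`exists_family`).  The second inclusion is strict because complexes with a local
construction are connected, unlike the disjoint union of two simplices.
-/

namespace SimplicialCW

variable {K : SimplicialCW} {d t : ℕ}

/-! ### Dimension -/

theorem dim_eq_card_of_iso {F : K.Face} {k : ℕ} (e : Set.Iic F ≃o Finset (Fin k)) (G : Set.Iic F) :
    K.dim G = ((e G).card : ℤ) - 1 := by
  have key : {v : K.Face | IsAtom v ∧ v ≤ G} =
      (fun i => ((e.symm {i} : Set.Iic F) : K.Face)) '' (e G : Set (Fin k)) := by
    ext v
    constructor
    · rintro ⟨hv, hvG⟩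
      have h1 : IsAtom (⟨v, hvG.trans G.2⟩ : Set.Iic F) := hv.Iic _
      rw [← e.isAtom_iff, Finset.isAtom_iff] at h1
      obtain ⟨i, hi⟩ := h1
      refine ⟨i, ?_, ?_⟩
      · have : e ⟨v, hvG.trans G.2⟩ ≤ e G := e.monotone hvG
        rw [hi] at this
        exact Finset.singleton_subset_iff.1 this
      · simp only [← hi, OrderIso.symm_apply_apply]
    · rintro ⟨i, hi, rfl⟩
      have h1 : IsAtom (e.symm {i}) := (e.symm.isAtom_iff _).2 (Finset.isAtom_singleton i)
      refine ⟨h1.of_isAtom_coe_Iic, ?_⟩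
      have : e.symm {i} ≤ G := by
        rw [e.symm_apply_le]
        exact Finset.singleton_subset_iff.2 hi
      exact this
  unfold dim
  rw [key, Set.ncard_image_of_injective, Set.ncard_coe_finset]
  intro i j hij
  exact Finset.singleton_injective (e.symm.injective (Subtype.ext hij))

theorem dim_eq_of_iicIso {L : SimplicialCW} {F : K.Face} {G : L.Face}
    (e : Set.Iic F ≃o Set.Iic G) : K.dim F = L.dim G := by
  obtain ⟨k, ⟨i⟩⟩ := L.boolean G
  have h1 := dim_eq_card_of_iso (e.trans i) ⊤
  have h2 := dim_eq_card_of_iso i ⊤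
  rw [map_top] at h1 h2
  exact h1.trans h2.symm

theorem dim_lt {F G : K.Face} (h : F < G) : K.dim F < K.dim G := by
  obtain ⟨k, ⟨e⟩⟩ := K.boolean G
  have h1 := dim_eq_card_of_iso e ⟨F, h.le⟩
  have h2 := dim_eq_card_of_iso e ⟨G, le_rfl⟩
  have : e ⟨F, h.le⟩ < e ⟨G, le_rfl⟩ := e.strictMono h
  have := Finset.card_lt_card this
  simp only at h1 h2
  omega

theorem eq_of_le_of_dim_le {F G : K.Face} (h : F ≤ G) (hd : K.dim G ≤ K.dim F) : F = G := by
  by_contra hne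
  have := dim_lt (lt_of_le_of_ne h hne)
  omega

theorem dim_bot : K.dim ⊥ = -1 := by
  have h : {v : K.Face | IsAtom v ∧ v ≤ ⊥} = ∅ :=
    Set.eq_empty_iff_forall_notMem.2 fun v hv => hv.1.1 (le_bot_iff.1 hv.2)
  unfold dim
  rw [h]
  simp

theorem neg_one_le_dim (F : K.Face) : -1 ≤ K.dim F := by
  unfold dim; omega

theorem eq_bot_of_dim {F : K.Face} (h : K.dim F ≤ -1) : F = ⊥ :=
  (eq_of_le_of_dim_le bot_le (by rw [dim_bot]; exact h)).symm

/-- A face has subfaces of every smaller dimension. -/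
theorem exists_le_dim_eq (F : K.Face) {n : ℤ} (h1 : -1 ≤ n) (h2 : n ≤ K.dim F) :
    ∃ G ≤ F, K.dim G = n := by
  obtain ⟨k, ⟨e⟩⟩ := K.boolean F
  have h3 := dim_eq_card_of_iso e ⟨F, le_rfl⟩
  simp only at h3
  obtain ⟨s, -, hs⟩ := Finset.exists_subset_card_eq (s := e ⟨F, le_rfl⟩) (n := (n + 1).toNat)
    (by omega)
  refine ⟨e.symm s, (e.symm s).2, ?_⟩
  rw [dim_eq_card_of_iso e, OrderIso.apply_symm_apply, hs]
  omega

theorem exists_maximal_ge {C : LowerSet K.Face} {G : K.Face} (hG : G ∈ C) :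
    ∃ F, G ≤ F ∧ Maximal (· ∈ C) F :=
  Set.Finite.exists_le_maximal (s := (C : Set K.Face)) (Set.toFinite _) hG

theorem IsPure.exists_ge {C : LowerSet K.Face} {e : ℤ} (hC : K.IsPure e C) {G : K.Face}
    (hG : G ∈ C) : ∃ F ∈ C, K.dim F = e ∧ G ≤ F := by
  obtain ⟨F, hGF, hF⟩ := exists_maximal_ge hG
  exact ⟨F, hF.1, hC.2 F hF, hGF⟩

theorem IsPure.dim_le {C : LowerSet K.Face} {e : ℤ} (hC : K.IsPure e C) {G : K.Face}
    (hG : G ∈ C) : K.dim G ≤ e := by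
  obtain ⟨F, -, hF, h⟩ := hC.exists_ge hG
  exact hF ▸ K.dim_mono h

theorem isPure_of {C : LowerSet K.Face} {e : ℤ} (h0 : ⊥ ∈ C)
    (h : ∀ G ∈ C, ∃ F ∈ C, K.dim F = e ∧ G ≤ F) : K.IsPure e C := by
  refine ⟨h0, fun F hF => ?_⟩
  obtain ⟨F', hF', hd, hle⟩ := h F hF.1
  rw [← hd, hF.eq_of_le hF' hle]

theorem IsPure.sup {C₁ C₂ : LowerSet K.Face} {e : ℤ} (h₁ : K.IsPure e C₁) (h₂ : K.IsPure e C₂) :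
    K.IsPure e (C₁ ⊔ C₂) := by
  refine isPure_of (Or.inl h₁.1) ?_
  rintro G (hG | hG)
  · obtain ⟨F, hF, h⟩ := h₁.exists_ge hG
    exact ⟨F, Or.inl hF, h⟩
  · obtain ⟨F, hF, h⟩ := h₂.exists_ge hG
    exact ⟨F, Or.inr hF, h⟩

theorem isPure_Iic {F : K.Face} {e : ℤ} (hF : K.dim F = e) : K.IsPure e (LowerSet.Iic F) :=
  isPure_of bot_le fun _ hG => ⟨F, le_rfl, hF, hG⟩

/-- In a pseudomanifold, two distinct facets through a ridge are all the facets through it. -/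
theorem IsPseudomanifold.eq_or_eq (hK : K.IsPseudomanifold d) {σ F₁ F₂ F : K.Face}
    (hσ : K.dim σ = (d : ℤ) - 1) (h₁ : K.dim F₁ = d) (h₂ : K.dim F₂ = d) (h : K.dim F = d)
    (l₁ : σ ≤ F₁) (l₂ : σ ≤ F₂) (l : σ ≤ F) (hne : F₁ ≠ F₂) : F = F₁ ∨ F = F₂ := by
  by_contra! hcon
  have h3 : ({F₁, F₂, F} : Set K.Face).ncard = 3 :=
    Set.ncard_eq_three.2 ⟨F₁, F₂, F, hne, hcon.1.symm, hcon.2.symm, rfl⟩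
  have := Set.ncard_le_ncard (s := {F₁, F₂, F}) (t := {F : K.Face | K.dim F = d ∧ σ ≤ F})
    (by rintro x (rfl | rfl | rfl) <;> simp [*]) (Set.toFinite _)
  have := hK.2 σ hσ
  omega

/-! ### Complexes glued from the facets of `K` along a set of ridges -/

/-- Two facets share a ridge from `E` that contains `G`. -/
def RidgeAdj (K : SimplicialCW) (d : ℕ) (E : Set K.Face) (G F F' : K.Face) : Prop :=
  K.dim F = d ∧ K.dim F' = d ∧ ∃ σ ∈ E, G ≤ σ ∧ σ ≤ F ∧ σ ≤ F'

/-- Two facets are joined by a sequence of facets, successive ones sharing a ridge from `E` that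
contains `G`: they lie in the same component of the star of `G` once only the ridges from `E` are
glued. -/
def Link (K : SimplicialCW) (d : ℕ) (E : Set K.Face) (G : K.Face) : K.Face → K.Face → Prop :=
  Relation.ReflTransGen (K.RidgeAdj d E G)

theorem RidgeAdj.symm {E : Set K.Face} {G F F' : K.Face} (h : K.RidgeAdj d E G F F') :
    K.RidgeAdj d E G F' F := by
  obtain ⟨h1, h2, σ, h3, h4, h5, h6⟩ := h
  exact ⟨h2, h1, σ, h3, h4, h6, h5⟩

theorem Link.symm {E : Set K.Face} {G F F' : K.Face} (h : K.Link d E G F F') :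
    K.Link d E G F' F :=
  have : Std.Symm (K.RidgeAdj d E G) := ⟨fun _ _ => RidgeAdj.symm⟩
  Relation.ReflTransGen.stdSymm.symm _ _ h

theorem Link.mono {E E' : Set K.Face} {G G' F F' : K.Face} (h : K.Link d E G F F')
    (hE : E ⊆ E') (hG : G' ≤ G) : K.Link d E' G' F F' :=
  Relation.ReflTransGen.mono
    (fun _ _ ⟨h1, h2, σ, h3, h4, h5⟩ => ⟨h1, h2, σ, hE h3, hG.trans h4, h5⟩) _ _ h

theorem Link.single {E : Set K.Face} {G F F' σ : K.Face} (hF : K.dim F = d) (hF' : K.dim F' = d)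
    (hσ : σ ∈ E) (hG : G ≤ σ) (h : σ ≤ F) (h' : σ ≤ F') : K.Link d E G F F' :=
  Relation.ReflTransGen.single ⟨hF, hF', σ, hσ, hG, h, h'⟩

/-- `K` has a facet, and the ridges in `E` connect all facets. -/
structure ConnectedBy (K : SimplicialCW) (d : ℕ) (E : Set K.Face) : Prop where
  nonempty : ∃ F : K.Face, K.dim F = d
  link : ∀ F F' : K.Face, K.dim F = d → K.dim F' = d → K.Link d E ⊥ F F'

theorem ConnectedBy.mono {E E' : Set K.Face} (h : K.ConnectedBy d E) (hE : E ⊆ E') :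
    K.ConnectedBy d E' :=
  ⟨h.nonempty, fun F F' hF hF' => (h.link F F' hF hF').mono hE le_rfl⟩

/-- A face of a facet of `K`. -/
def Flag (K : SimplicialCW) (d : ℕ) : Type :=
  {p : K.Face × K.Face // p.1 ≤ p.2 ∧ K.dim p.2 = d}

/-- Two copies of a face in two facets become the same face when the ridges in `E` are glued. -/
def flagSetoid (K : SimplicialCW) (d : ℕ) (E : Set K.Face) : Setoid (K.Flag d) where
  r p q := p.1.1 = q.1.1 ∧ K.Link d E p.1.1 p.1.2 q.1.2
  iseqv :=
    { refl := fun _ => ⟨rfl, Relation.ReflTransGen.refl⟩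
      symm := fun h => ⟨h.1.symm, h.1 ▸ h.2.symm⟩
      trans := fun h h' => ⟨h.1.trans h'.1, h.2.trans (h.1 ▸ h'.2)⟩ }

/-- The faces of the complex obtained from the disjoint union of the facets of `K` by gluing only
along the ridges in `E`. -/
def CutFace (K : SimplicialCW) (d : ℕ) (E : Set K.Face) : Type :=
  Quotient (K.flagSetoid d E)

/-- The copy of the face `G` in the facet `F`. -/
def CutFace.mk (E : Set K.Face) {G F : K.Face} (h : G ≤ F) (hF : K.dim F = d) : K.CutFace d E :=
  Quotient.mk (K.flagSetoid d E) ⟨(G, F), h, hF⟩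

theorem CutFace.ind {E : Set K.Face} {p : K.CutFace d E → Prop}
    (h : ∀ (G F : K.Face) (hG : G ≤ F) (hF : K.dim F = d), p (CutFace.mk E hG hF)) (x) : p x :=
  Quotient.ind (fun ⟨⟨G, F⟩, hG, hF⟩ => h G F hG hF) x

instance (E : Set K.Face) : Finite (K.CutFace d E) := by
  have : Finite (K.Flag d) := Subtype.finite
  exact Quotient.finite _

/-- The underlying face of `K`. -/
def CutFace.face {E : Set K.Face} : K.CutFace d E → K.Face :=
  Quotient.lift (fun p => p.1.1) fun _ _ h => h.1

instance (E : Set K.Face) : LE (K.CutFace d E) where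
  le := Quotient.lift₂ (fun p q => p.1.1 ≤ q.1.1 ∧ K.Link d E p.1.1 p.1.2 q.1.2) (by
    rintro ⟨⟨G, F⟩, hG, hF⟩ ⟨⟨G', F'⟩, hG', hF'⟩ ⟨⟨H, I⟩, hH, hI⟩ ⟨⟨H', I'⟩, hH', hI'⟩ ⟨h1, h2⟩
      ⟨h3, h4⟩
    dsimp only at h1 h2 h3 h4 ⊢
    subst h1 h3
    refine propext (and_congr_right fun hle => ?_)
    have h4' := h4.mono le_rfl hle
    exact ⟨fun h => h2.symm.trans (h.trans h4'), fun h => h2.trans (h.trans h4'.symm)⟩)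

theorem CutFace.mk_le_mk {E : Set K.Face} {G F G' F' : K.Face} {h : G ≤ F} {hF : K.dim F = d}
    {h' : G' ≤ F'} {hF' : K.dim F' = d} :
    CutFace.mk E h hF ≤ CutFace.mk E h' hF' ↔ G ≤ G' ∧ K.Link d E G F F' :=
  Iff.rfl

theorem CutFace.mk_eq_mk {E : Set K.Face} {G F G' F' : K.Face} {h : G ≤ F} {hF : K.dim F = d}
    {h' : G' ≤ F'} {hF' : K.dim F' = d} :
    CutFace.mk E h hF = CutFace.mk E h' hF' ↔ G = G' ∧ K.Link d E G F F' :=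
  Quotient.eq (r := K.flagSetoid d E)

instance (E : Set K.Face) : PartialOrder (K.CutFace d E) where
  le_refl x := by
    induction x using CutFace.ind with | h G F hG hF =>
    exact CutFace.mk_le_mk.2 ⟨le_rfl, Relation.ReflTransGen.refl⟩
  le_trans x y z := by
    induction x using CutFace.ind with | h G F hG hF =>
    induction y using CutFace.ind with | h G' F' hG' hF' =>
    induction z using CutFace.ind with | h G'' F'' hG'' hF'' =>
    simp only [CutFace.mk_le_mk]
    exact fun h h' => ⟨h.1.trans h'.1, h.2.trans (h'.2.mono le_rfl h.1)⟩
  le_antisymm x y := by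
    induction x using CutFace.ind with | h G F hG hF =>
    induction y using CutFace.ind with | h G' F' hG' hF' =>
    simp only [CutFace.mk_le_mk, CutFace.mk_eq_mk]
    exact fun h h' => ⟨h.1.antisymm h'.1, h.2⟩

/-- The faces below the copy of `G` in `F` are the copies of the faces of `G` in `F`. -/
noncomputable def CutFace.iicIso (E : Set K.Face) {G F : K.Face} (hG : G ≤ F) (hF : K.dim F = d) :
    Set.Iic G ≃o Set.Iic (CutFace.mk E hG hF) := by
  refine RelIso.ofSurjective (OrderEmbedding.ofMapLEIff (fun H : Set.Iic G =>
    ⟨CutFace.mk E (le_trans H.2 hG) hF, ?_⟩) ?_) ?_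
  · exact Set.mem_Iic.2 (CutFace.mk_le_mk.2 ⟨H.2, Relation.ReflTransGen.refl⟩)
  · intro H H'
    rw [Subtype.mk_le_mk, CutFace.mk_le_mk]
    exact ⟨fun h => h.1, fun h => ⟨h, Relation.ReflTransGen.refl⟩⟩
  · rintro ⟨x, hx⟩
    induction x using CutFace.ind with | h H I hH hI =>
    have hx' := CutFace.mk_le_mk.1 (Set.mem_Iic.1 hx)
    refine ⟨⟨H, hx'.1⟩, Subtype.ext (?_ : CutFace.mk E (hx'.1.trans hG) hF = CutFace.mk E hH hI)⟩
    exact CutFace.mk_eq_mk.2 ⟨rfl, hx'.2.symm⟩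

theorem CutFace.iicIso_apply (E : Set K.Face) {G F : K.Face} (hG : G ≤ F) (hF : K.dim F = d)
    (H : Set.Iic G) : (CutFace.iicIso E hG hF H : K.CutFace d E) = CutFace.mk E (H.2.trans hG) hF :=
  rfl

theorem CutFace.iicIso_symm_apply (E : Set K.Face) {G F H I : K.Face} (hG : G ≤ F)
    (hF : K.dim F = d) (hH : H ≤ I) (hI : K.dim I = d)
    (h : CutFace.mk E hH hI ≤ CutFace.mk E hG hF) :
    (CutFace.iicIso E hG hF).symm ⟨CutFace.mk E hH hI, h⟩ = ⟨H, (CutFace.mk_le_mk.1 h).1⟩ := by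
  rw [OrderIso.symm_apply_eq]
  refine Subtype.ext (?_ : CutFace.mk E hH hI = CutFace.mk E ((CutFace.mk_le_mk.1 h).1.trans hG) hF)
  exact CutFace.mk_eq_mk.2 ⟨rfl, (CutFace.mk_le_mk.1 h).2⟩

/-- The complex obtained from the disjoint union of the facets of `K` by gluing only along the
ridges in `E`, which are assumed to connect all facets so that there is a single empty face. -/
noncomputable abbrev cut (K : SimplicialCW) (d : ℕ) (E : Set K.Face) (hE : K.ConnectedBy d E) :
    SimplicialCW where
  Face := K.CutFace d E
  orderBot :=
    { bot := CutFace.mk E bot_le hE.nonempty.choose_spec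
      bot_le := fun x => by
        induction x using CutFace.ind with | h G F hG hF =>
        exact CutFace.mk_le_mk.2 ⟨bot_le, hE.link _ _ hE.nonempty.choose_spec hF⟩ }
  boolean x := by
    induction x using CutFace.ind with | h G F hG hF =>
    obtain ⟨k, ⟨e⟩⟩ := K.boolean G
    exact ⟨k, ⟨(CutFace.iicIso E hG hF).symm.trans e⟩⟩

theorem dim_cut_mk {E : Set K.Face} (hE : K.ConnectedBy d E) {G F : K.Face} (hG : G ≤ F)
    (hF : K.dim F = d) : (K.cut d E hE).dim (CutFace.mk E hG hF) = K.dim G :=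
  (dim_eq_of_iicIso (L := K.cut d E hE) (CutFace.iicIso E hG hF)).symm

/-- The facets of the cut complex are the facets of `K`. -/
theorem exists_eq_mk_of_dim {E : Set K.Face} (hE : K.ConnectedBy d E) {x : (K.cut d E hE).Face}
    (hx : (K.cut d E hE).dim x = d) :
    ∃ (F : K.Face) (hF : K.dim F = d), x = CutFace.mk E le_rfl hF := by
  induction x using CutFace.ind with | h G F hG hF =>
  rw [dim_cut_mk] at hx
  obtain rfl := eq_of_le_of_dim_le hG (by omega)
  exact ⟨G, hF, rfl⟩

/-- If no ridge of `E` contains `G`, the copies of `G` in different facets are different. -/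
theorem Link.eq_of_forall_not_le {E : Set K.Face} {G F F' : K.Face} (h : K.Link d E G F F')
    (hG : ∀ σ ∈ E, ¬ G ≤ σ) : F = F' := by
  induction h with
  | refl => rfl
  | tail _ h _ => obtain ⟨-, -, σ, hσ, hle, -⟩ := h; exact absurd hle (hG σ hσ)

/-- Gluing one more ridge `σ` is a `t`-LC gluing if the two copies of `σ` share a face `τ` of
dimension at least `d - 1 - t`. -/
theorem isTLCGluing_cut (hK : K.IsPseudomanifold d) {E : Set K.Face}
    (hdim : ∀ ρ ∈ E, K.dim ρ = (d : ℤ) - 1) (hE : K.ConnectedBy d E) {σ F₁ F₂ τ : K.Face}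
    (hσ : K.dim σ = (d : ℤ) - 1) (hσE : σ ∉ E) (hne : F₁ ≠ F₂) (hF₁ : K.dim F₁ = d)
    (hF₂ : K.dim F₂ = d) (h₁ : σ ≤ F₁) (h₂ : σ ≤ F₂) (hτ : τ ≤ σ)
    (hτd : (d : ℤ) - 1 - t ≤ K.dim τ) (hlink : K.Link d E τ F₁ F₂)
    (hE' : K.ConnectedBy d (insert σ E)) :
    IsTLCGluing d t (K.cut d E hE) (K.cut d (insert σ E) hE') := by
  have hnot : ∀ ρ ∈ E, ¬ σ ≤ ρ := fun ρ hρ hle =>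
    hσE (eq_of_le_of_dim_le hle (by rw [hσ, hdim ρ hρ]) ▸ hρ)
  have hbdry : ∀ (F : K.Face) (hF : K.dim F = d) (h : σ ≤ F),
      (K.cut d E hE).IsBoundaryFacet d ⊤ (CutFace.mk E h hF) := by
    intro F hF h
    refine ⟨by rw [dim_cut_mk, hσ], CutFace.mk E le_rfl hF, ⟨trivial, by rw [dim_cut_mk, hF],
      CutFace.mk_le_mk.2 ⟨h, Relation.ReflTransGen.refl⟩⟩, ?_⟩
    rintro x ⟨-, hx, hle⟩
    obtain ⟨F', hF', rfl⟩ := exists_eq_mk_of_dim hE hx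
    obtain rfl := (CutFace.mk_le_mk.1 hle).2.eq_of_forall_not_le hnot
    rfl
  let φ : Set.Iic (CutFace.mk E h₁ hF₁) ≃o Set.Iic (CutFace.mk E h₂ hF₂) :=
    (CutFace.iicIso E h₁ hF₁).symm.trans (CutFace.iicIso E h₂ hF₂)
  have hφ : ∀ (G F : K.Face) (hG : G ≤ F) (hF : K.dim F = d)
      (h : CutFace.mk E hG hF ≤ CutFace.mk E h₁ hF₁),
      (φ ⟨CutFace.mk E hG hF, h⟩ : K.CutFace d E) =
        CutFace.mk E ((CutFace.mk_le_mk.1 h).1.trans h₂) hF₂ := by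
    intro G F hG hF h
    simp only [φ, OrderIso.trans_apply, CutFace.iicIso_symm_apply E h₁ hF₁ hG hF h,
      CutFace.iicIso_apply]
  let π : K.CutFace d E → K.CutFace d (insert σ E) :=
    Quotient.map' id fun p q h => ⟨h.1, h.2.mono (Set.subset_insert _ _) le_rfl⟩
  have hπ : ∀ (G F : K.Face) (hG : G ≤ F) (hF : K.dim F = d),
      π (CutFace.mk E hG hF) = CutFace.mk (insert σ E) hG hF := fun _ _ _ _ => rfl
  refine ⟨CutFace.mk E h₁ hF₁, CutFace.mk E h₂ hF₂, ?_, hbdry F₁ hF₁ h₁, hbdry F₂ hF₂ h₂, ?_,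
    φ, π, ?_, ?_, ?_⟩
  · intro h
    exact hne ((CutFace.mk_eq_mk.1 h).2.eq_of_forall_not_le hnot)
  · exact ⟨CutFace.mk E (hτ.trans h₁) hF₁,
      CutFace.mk_le_mk.2 ⟨hτ, Relation.ReflTransGen.refl⟩, CutFace.mk_le_mk.2 ⟨hτ, hlink⟩,
      by rw [dim_cut_mk]; exact hτd⟩
  · intro x
    induction x using CutFace.ind with | h G F hG hF =>
    exact ⟨CutFace.mk E hG hF, hπ G F hG hF⟩
  · intro x y
    constructor
    · induction x using CutFace.ind with | h G F hG hF =>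
      induction y using CutFace.ind with | h G' F' hG' hF' =>
      rw [hπ, hπ, CutFace.mk_eq_mk]
      rintro ⟨rfl, h⟩
      induction h with
      | refl => exact Relation.EqvGen.refl _
      | @tail b c hb hbc ih =>
        obtain ⟨hb', -, ρ, hρ, hGρ, hρb, hρc⟩ := hbc
        refine (ih hb' (hGρ.trans hρb)).trans _ _ _ ?_
        rcases hρ with rfl | hρ
        · have hcb : ∀ (F : K.Face) (hF : K.dim F = d) (h : ρ ≤ F),
              CutFace.mk E (hGρ.trans h) hF = CutFace.mk E (hGρ.trans h₁) hF₁ ∨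
              CutFace.mk E (hGρ.trans h) hF = CutFace.mk E (hGρ.trans h₂) hF₂ := by
            intro F hF h
            rcases hK.eq_or_eq hσ hF₁ hF₂ hF h₁ h₂ h hne with rfl | rfl
            · exact Or.inl rfl
            · exact Or.inr rfl
          have hstep : Relation.EqvGen (fun a b : K.CutFace d E =>
              ∃ h : a ≤ CutFace.mk E h₁ hF₁, (φ ⟨a, h⟩ : K.CutFace d E) = b)
              (CutFace.mk E (hGρ.trans h₁) hF₁) (CutFace.mk E (hGρ.trans h₂) hF₂) :=
            Relation.EqvGen.rel _ _ ⟨CutFace.mk_le_mk.2 ⟨hGρ, Relation.ReflTransGen.refl⟩,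
              hφ _ _ _ _ _⟩
          rcases hcb b hb' hρb with h | h <;> rcases hcb c hF' hρc with h' | h' <;> rw [h, h']
          · exact Relation.EqvGen.refl _
          · exact hstep
          · exact hstep.symm
          · exact Relation.EqvGen.refl _
        · rw [CutFace.mk_eq_mk.2 ⟨rfl, Link.single hb' hF' hρ hGρ hρb hρc⟩]
          exact Relation.EqvGen.refl _
    · intro h
      induction h with
      | rel a b h =>
        obtain ⟨h, rfl⟩ := h
        induction a using CutFace.ind with | h G F hG hF =>
        have h' := CutFace.mk_le_mk.1 h
        rw [hφ, hπ, hπ, CutFace.mk_eq_mk]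
        exact ⟨rfl, (h'.2.mono (Set.subset_insert _ _) le_rfl).trans
          (Link.single hF₁ hF₂ (Set.mem_insert _ _) h'.1 h₁ h₂)⟩
      | refl => rfl
      | symm _ _ _ ih => exact ih.symm
      | trans _ _ _ _ _ ih ih' => exact ih.trans ih'
  · intro x y
    constructor
    · induction x using CutFace.ind with | h G F hG hF =>
      induction y using CutFace.ind with | h G' F' hG' hF' =>
      rw [hπ, hπ, CutFace.mk_le_mk]
      intro h'
      exact ⟨CutFace.mk E (h'.1.trans hG') hF', CutFace.mk E hG' hF',
        by rw [hπ, CutFace.mk_eq_mk]; exact ⟨rfl, h'.2.symm⟩, rfl,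
        CutFace.mk_le_mk.2 ⟨h'.1, Relation.ReflTransGen.refl⟩⟩
    · rintro ⟨x', y', hx, hy, hle⟩
      rw [← hx, ← hy]
      induction x' using CutFace.ind with | h G F hG hF =>
      induction y' using CutFace.ind with | h G' F' hG' hF' =>
      have h' := CutFace.mk_le_mk.1 hle
      rw [hπ, hπ, CutFace.mk_le_mk]
      exact ⟨h'.1, h'.2.mono (Set.subset_insert _ _) le_rfl⟩

/-! ### Invariance under isomorphism -/

/-- The image of a subcomplex under an isomorphism of face posets. -/
def mapLowerSet {M N : SimplicialCW} (e : M.Face ≃o N.Face) (C : LowerSet M.Face) :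
    LowerSet N.Face where
  carrier := {y | e.symm y ∈ C}
  lower' := fun _ _ hba ha => C.lower (e.symm.monotone hba) ha

theorem mapLowerSet_Iic {M N : SimplicialCW} (e : M.Face ≃o N.Face) (F : M.Face) :
    mapLowerSet e (LowerSet.Iic F) = LowerSet.Iic (e F) :=
  LowerSet.ext (Set.ext fun _ => e.symm_apply_le)

theorem dim_map {M N : SimplicialCW} (e : M.Face ≃o N.Face) (F : M.Face) :
    N.dim (e F) = M.dim F :=
  dim_eq_of_iicIso
    { toFun := fun G => ⟨e.symm G, e.symm_apply_le.2 G.2⟩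
      invFun := fun G => ⟨e G, e.monotone G.2⟩
      left_inv := fun G => Subtype.ext (e.apply_symm_apply G)
      right_inv := fun G => Subtype.ext (e.symm_apply_apply G)
      map_rel_iff' := e.symm.le_iff_le }

theorem IsTreeSub.map {M N : SimplicialCW} (e : M.Face ≃o N.Face) {C : LowerSet M.Face}
    (h : M.IsTreeSub d C) : N.IsTreeSub d (mapLowerSet e C) := by
  induction h with
  | simplex F hF =>
    rw [mapLowerSet_Iic]
    exact IsTreeSub.simplex _ (by rw [dim_map, hF])
  | attach C σ F hC hσ hF hint ih =>
    have h1 : mapLowerSet e (C ⊔ LowerSet.Iic F) = mapLowerSet e C ⊔ LowerSet.Iic (e F) := by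
      rw [← mapLowerSet_Iic]; rfl
    have h2 : mapLowerSet e C ⊓ LowerSet.Iic (e F) = LowerSet.Iic (e σ) := by
      rw [← mapLowerSet_Iic, ← mapLowerSet_Iic, ← hint]; rfl
    rw [h1]
    refine IsTreeSub.attach _ (e σ) (e F) ih ⟨by rw [dim_map, hσ.1], ?_⟩ (by rw [dim_map, hF]) h2
    obtain ⟨G, ⟨hG, hGd, hle⟩, huniq⟩ := hσ.2
    refine ⟨e G, ⟨?_, by rw [dim_map, hGd], e.monotone hle⟩, ?_⟩
    · change e.symm (e G) ∈ C
      rwa [e.symm_apply_apply]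
    · rintro H ⟨hH, hHd, hHle⟩
      rw [← huniq (e.symm H) ⟨hH, by rw [dim_map, hHd], e.le_symm_apply.2 hHle⟩,
        e.apply_symm_apply]

theorem HasTLocalConstruction.of_iso {M N : SimplicialCW} (e : M.Face ≃o N.Face)
    (h : M.HasTLocalConstruction d t) : N.HasTLocalConstruction d t := by
  obtain ⟨T, hT, h⟩ := h
  rcases Relation.ReflTransGen.cases_tail h with rfl | ⟨Q, hTQ, hQ⟩
  · exact ⟨N, hT.map e, Relation.ReflTransGen.refl⟩
  · refine ⟨T, hT, hTQ.tail ?_⟩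
    obtain ⟨Δ, Δ', hne, hΔ, hΔ', hτ, φ, π, hsurj, heq, hle⟩ := hQ
    refine ⟨Δ, Δ', hne, hΔ, hΔ', hτ, φ, fun x => e (π x), e.surjective.comp hsurj, ?_, ?_⟩
    · intro x y
      rw [e.injective.eq_iff, heq]
    · intro x y
      simp only [e.le_iff_le, e.injective.eq_iff, hle]

/-! ### Trees of simplices from spanning trees of the dual graph -/

/-- One step in growing a tree in the dual graph: `A` is a set of facets and `T` a set of ridges; a
facet `F'` outside `A` is attached to a facet in `A` along a common ridge `σ`. -/
inductive Attach (K : SimplicialCW) (d : ℕ) :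
    Set K.Face × Set K.Face → Set K.Face × Set K.Face → Prop
  | mk (A T : Set K.Face) (σ F F' : K.Face) (hF : F ∈ A) (hF' : F' ∉ A) (hFd' : K.dim F' = d)
      (hσ : K.dim σ = (d : ℤ) - 1) (h : σ ≤ F) (h' : σ ≤ F') :
      Attach K d (A, T) (insert F' A, insert σ T)

/-- `T` is the set of ridges of a tree in the dual graph with vertex set `A`, grown from `F₀`. -/
def IsDualTree (K : SimplicialCW) (d : ℕ) (F₀ : K.Face) (p : Set K.Face × Set K.Face) : Prop :=
  Relation.ReflTransGen (K.Attach d) ({F₀}, ∅) p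

/-- `A` consists of facets, `T` of ridges, and `A` contains all facets through ridges in `T`. -/
structure IsClosedPair (K : SimplicialCW) (d : ℕ) (p : Set K.Face × Set K.Face) : Prop where
  dim_facet : ∀ F ∈ p.1, K.dim F = d
  dim_ridge : ∀ σ ∈ p.2, K.dim σ = (d : ℤ) - 1
  mem : ∀ σ ∈ p.2, ∀ F, K.dim F = d → σ ≤ F → F ∈ p.1

theorem Attach.isClosedPair (hK : K.IsPseudomanifold d) {p q : Set K.Face × Set K.Face}
    (h : K.Attach d p q) (hp : K.IsClosedPair d p) : K.IsClosedPair d q := by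
  obtain ⟨A, T, σ, F, F', hF, hF', hFd', hσ, h, h'⟩ := h
  obtain ⟨h1, h2, h3⟩ := hp
  refine ⟨?_, ?_, ?_⟩
  · rintro G (rfl | hG)
    exacts [hFd', h1 G hG]
  · rintro ρ (rfl | hρ)
    exacts [hσ, h2 ρ hρ]
  · rintro ρ (rfl | hρ) G hG hle
    · have hne : F ≠ F' := fun h => hF' (h ▸ hF)
      rcases hK.eq_or_eq hσ (h1 F hF) hFd' hG h h' hle hne with rfl | rfl
      · exact Or.inr hF
      · exact Or.inl rfl
    · exact Or.inr (h3 ρ hρ G hG hle)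

theorem isClosedPair_singleton {F₀ : K.Face} (h : K.dim F₀ = d) : K.IsClosedPair d ({F₀}, ∅) :=
  ⟨by rintro _ rfl; exact h, by rintro _ ⟨⟩, by rintro _ ⟨⟩⟩

theorem IsDualTree.isClosedPair (hK : K.IsPseudomanifold d) {F₀ : K.Face} (h₀ : K.dim F₀ = d)
    {p : Set K.Face × Set K.Face} (h : K.IsDualTree d F₀ p) : K.IsClosedPair d p := by
  induction h with
  | refl => exact isClosedPair_singleton h₀
  | tail _ h ih => exact h.isClosedPair hK ih

/-- Growing a dual tree creates no new connections between the old facets: collapsing each new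
leaf onto its neighbour is a retraction. -/
theorem Attach.link_of_link {p q : Set K.Face × Set K.Face} (h : K.Attach d p q)
    (hK : K.IsPseudomanifold d) (hp : K.IsClosedPair d p) {G F₁ F₂ : K.Face} (h₁ : F₁ ∈ p.1)
    (h₂ : F₂ ∈ p.1) (hl : K.Link d q.2 G F₁ F₂) : K.Link d p.2 G F₁ F₂ := by
  classical
  obtain ⟨A, T, σ, F, F', hF, hF', hFd', hσ, h, h'⟩ := h
  have hFF' : F ≠ F' := fun h => hF' (h ▸ hF)
  have key : ∀ X Y, K.Link d (insert σ T) G X Y →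
      K.Link d T G (if X = F' then F else X) (if Y = F' then F else Y) := by
    intro X Y hXY
    induction hXY with
    | refl => exact Relation.ReflTransGen.refl
    | tail _ hbc ih =>
      obtain ⟨hb, hc, ρ, hρ, hGρ, hρb, hρc⟩ := hbc
      refine ih.trans ?_
      rcases hρ with rfl | hρ
      · have : ∀ Z, K.dim Z = d → ρ ≤ Z → (if Z = F' then F else Z) = F := by
          intro Z hZ hle
          rcases hK.eq_or_eq hσ (hp.dim_facet F hF) hFd' hZ h h' hle hFF' with rfl | rfl
          · rw [if_neg hFF']
          · rw [if_pos rfl]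
        rw [this _ hb hρb, this _ hc hρc]
      · have : ∀ Z, K.dim Z = d → ρ ≤ Z → (if Z = F' then F else Z) = Z := by
          intro Z hZ hle
          exact if_neg fun h : Z = F' => hF' (h ▸ hp.mem ρ hρ Z hZ hle)
        rw [this _ hb hρb, this _ hc hρc]
        exact Link.single hb hc hρ hGρ hρb hρc
  have := key F₁ F₂ hl
  rwa [if_neg fun h => hF' (by rw [← h]; exact h₁), if_neg fun h => hF' (by rw [← h]; exact h₂)]
    at this

theorem link_of_link_of_reflTransGen (hK : K.IsPseudomanifold d) {p q : Set K.Face × Set K.Face}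
    (h : Relation.ReflTransGen (K.Attach d) p q) (hp : K.IsClosedPair d p) {G F₁ F₂ : K.Face}
    (h₁ : F₁ ∈ p.1) (h₂ : F₂ ∈ p.1) (hl : K.Link d q.2 G F₁ F₂) : K.Link d p.2 G F₁ F₂ := by
  induction h using Relation.ReflTransGen.head_induction_on with
  | refl => exact hl
  | head h _ ih =>
    refine h.link_of_link hK hp h₁ h₂ (ih (h.isClosedPair hK hp) ?_ ?_)
    · cases h; exact Or.inr h₁
    · cases h; exact Or.inr h₂

/-- The subcomplex of the cut complex formed by the facets in `A`. -/
def cutSub (K : SimplicialCW) (d : ℕ) (E A : Set K.Face) : LowerSet (K.CutFace d E) where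
  carrier := {x | ∃ F ∈ A, ∃ hF : K.dim F = d, x ≤ CutFace.mk E le_rfl hF}
  lower' := fun _ _ hba ⟨F, hF, hFd, h⟩ => ⟨F, hF, hFd, hba.trans h⟩

/-- A dual tree spanning all facets gives a tree of simplices. -/
theorem IsDualTree.isTreeOfSimplices (hK : K.IsPseudomanifold d) {F₀ : K.Face}
    (h₀ : K.dim F₀ = d) {T : Set K.Face} (h : K.IsDualTree d F₀ ({F | K.dim F = d}, T))
    (hT : K.ConnectedBy d T) : (K.cut d T hT).IsTreeOfSimplices d := by
  have key : ∀ p, K.IsDualTree d F₀ p →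
      Relation.ReflTransGen (K.Attach d) p ({F | K.dim F = d}, T) →
      (K.cut d T hT).IsTreeSub d (K.cutSub d T p.1) := by
    intro p hp
    induction hp with
    | refl =>
      intro _
      have : K.cutSub d T {F₀} = LowerSet.Iic (CutFace.mk T le_rfl h₀) := by
        ext x
        constructor
        · rintro ⟨F, rfl, _, hx⟩
          exact hx
        · intro hx
          exact ⟨F₀, rfl, h₀, hx⟩
      rw [this]
      exact IsTreeSub.simplex _ (by rw [dim_cut_mk, h₀])
    | @tail p q hp hpq ih =>
      intro hqT
      have ihp := ih (hqT.head hpq)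
      have hcp : K.IsClosedPair d p := IsDualTree.isClosedPair hK h₀ hp
      have hcq : K.IsClosedPair d q := hpq.isClosedPair hK hcp
      obtain ⟨A, S, σ, F, F', hF, hF', hFd', hσ, hσF, hσF'⟩ := hpq
      have hFd : K.dim F = d := hcp.dim_facet F hF
      have hne : F ≠ F' := fun h => hF' (h ▸ hF)
      have hlink : ∀ {G X Y : K.Face}, X ∈ insert F' A → Y ∈ insert F' A → K.Link d T G X Y →
          K.Link d (insert σ S) G X Y := fun hX hY hl =>
        link_of_link_of_reflTransGen hK hqT hcq hX hY hl
      have hsup : K.cutSub d T (insert F' A) =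
          K.cutSub d T A ⊔ LowerSet.Iic (CutFace.mk T le_rfl hFd') := by
        ext x
        constructor
        · rintro ⟨X, rfl | hX, hXd, hx⟩
          · exact Or.inr hx
          · exact Or.inl ⟨X, hX, hXd, hx⟩
        · rintro (⟨X, hX, hXd, hx⟩ | hx)
          · exact ⟨X, Or.inr hX, hXd, hx⟩
          · exact ⟨F', Or.inl rfl, hFd', hx⟩
      have hσT : σ ∈ T := by
        have : ∀ {a b : Set K.Face × Set K.Face}, Relation.ReflTransGen (K.Attach d) a b →
            a.2 ⊆ b.2 := by
          intro a b h
          induction h with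
          | refl => exact subset_rfl
          | tail _ h ih => cases h; exact ih.trans (Set.subset_insert _ _)
        exact this hqT (Set.mem_insert _ _)
      have hmk : CutFace.mk T hσF hFd = CutFace.mk T hσF' hFd' :=
        CutFace.mk_eq_mk.2 ⟨rfl, Link.single hFd hFd' hσT le_rfl hσF hσF'⟩
      rw [hsup]
      refine IsTreeSub.attach (K := K.cut d T hT) _ (CutFace.mk T hσF hFd) _ ihp
        ⟨by rw [dim_cut_mk, hσ], ?_⟩ (by rw [dim_cut_mk, hFd']) ?_
      · refine ⟨CutFace.mk T le_rfl hFd, ⟨⟨F, hF, hFd, le_rfl⟩, by rw [dim_cut_mk, hFd],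
          CutFace.mk_le_mk.2 ⟨hσF, Relation.ReflTransGen.refl⟩⟩, ?_⟩
        rintro x ⟨⟨X, hX, hXd, hxX⟩, hx, hle⟩
        obtain ⟨Y, hY, rfl⟩ := exists_eq_mk_of_dim hT hx
        obtain rfl : Y = X := eq_of_le_of_dim_le (CutFace.mk_le_mk.1 hxX).1 (by omega)
        rcases hK.eq_or_eq hσ hFd hFd' hY hσF hσF' (CutFace.mk_le_mk.1 hle).1 hne with rfl | rfl
        · rfl
        · exact absurd hX hF'
      · ext x
        constructor
        · rintro ⟨⟨X, hX, hXd, hxX⟩, hx⟩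
          have hx' : x ≤ CutFace.mk T le_rfl hFd' := hx
          induction x using CutFace.ind with | h G Y hG hY =>
          have h1 := CutFace.mk_le_mk.1 hxX
          have h2 := CutFace.mk_le_mk.1 hx'
          have h3 := hlink (Or.inr hX) (Or.inl rfl) (h1.2.symm.trans h2.2)
          have h4 : G ≤ σ := by
            by_contra hcon
            rcases Relation.ReflTransGen.cases_tail h3 with h | ⟨Z, -, hZ, -, ρ, hρ, hGρ, -, hρF'⟩
            · exact hF' (h ▸ hX)
            · rcases hρ with rfl | hρ
              · exact hcon hGρ
              · exact hF' (hcp.mem ρ hρ F' hFd' hρF')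
          change CutFace.mk T hG hY ≤ CutFace.mk T hσF hFd
          rw [hmk]
          exact CutFace.mk_le_mk.2 ⟨h4, h2.2⟩
        · intro hx
          have hx' : x ≤ CutFace.mk T hσF hFd := hx
          refine ⟨⟨F, hF, hFd, hx'.trans (CutFace.mk_le_mk.2 ⟨hσF, Relation.ReflTransGen.refl⟩)⟩,
            ?_⟩
          change x ≤ CutFace.mk T le_rfl hFd'
          rw [hmk] at hx'
          exact hx'.trans (CutFace.mk_le_mk.2 ⟨hσF', Relation.ReflTransGen.refl⟩)
  have htop : K.cutSub d T {F | K.dim F = d} = ⊤ := by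
    ext x
    refine ⟨fun _ => trivial, fun _ => ?_⟩
    induction x using CutFace.ind with | h G F hG hF =>
    exact ⟨F, hF, hF, CutFace.mk_le_mk.2 ⟨hG, Relation.ReflTransGen.refl⟩⟩
  have := key _ h Relation.ReflTransGen.refl
  rw [htop] at this
  exact this

/-! ### Local constructions as orderings of the ridges -/

/-- The ridge `σ` may be added to the glued ridges `E` by a `t`-LC gluing: it separates two facets
that already are joined in the star of some face of `σ` of dimension at least `d - 1 - t`. -/
inductive GlueStep (K : SimplicialCW) (d t : ℕ) : Set K.Face → Set K.Face → Prop
  | mk (E : Set K.Face) (σ F₁ F₂ τ : K.Face) (hσ : K.dim σ = (d : ℤ) - 1) (hσE : σ ∉ E)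
      (hne : F₁ ≠ F₂) (hF₁ : K.dim F₁ = d) (hF₂ : K.dim F₂ = d) (h₁ : σ ≤ F₁) (h₂ : σ ≤ F₂)
      (hτ : τ ≤ σ) (hτd : (d : ℤ) - 1 - t ≤ K.dim τ) (hlink : K.Link d E τ F₁ F₂) :
      GlueStep K d t E (insert σ E)

/-- The ridges in `E'` can be glued one after the other when those in `E` are glued already. -/
def Reach (K : SimplicialCW) (d t : ℕ) : Set K.Face → Set K.Face → Prop :=
  Relation.ReflTransGen (K.GlueStep d t)

theorem Reach.subset {E E' : Set K.Face} (h : K.Reach d t E E') : E ⊆ E' := by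
  induction h with
  | refl => exact subset_rfl
  | tail _ h ih => cases h; exact ih.trans (Set.subset_insert _ _)

/-- Gluings stay possible when more ridges are glued beforehand. -/
theorem Reach.union {E E' : Set K.Face} (h : K.Reach d t E E') (S : Set K.Face) :
    K.Reach d t (E ∪ S) (E' ∪ S) := by
  induction h with
  | refl => exact Relation.ReflTransGen.refl
  | tail _ h ih =>
    obtain ⟨σ, F₁, F₂, τ, hσ, hσE, hne, hF₁, hF₂, h₁, h₂, hτ, hτd, hlink⟩ := h
    by_cases hS : σ ∈ S
    · rwa [Set.insert_union, Set.insert_eq_of_mem (Set.mem_union_right _ hS)]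
    · rw [Set.insert_union]
      exact ih.tail (GlueStep.mk _ σ F₁ F₂ τ hσ (by rintro (h | h) <;> contradiction) hne hF₁ hF₂
        h₁ h₂ hτ hτd (hlink.mono Set.subset_union_left le_rfl))

theorem Reach.cut (hK : K.IsPseudomanifold d) {E E' : Set K.Face} (h : K.Reach d t E E')
    (hdim : ∀ ρ ∈ E, K.dim ρ = (d : ℤ) - 1) (hE : K.ConnectedBy d E) (hE' : K.ConnectedBy d E') :
    Relation.ReflTransGen (IsTLCGluing d t) (K.cut d E hE) (K.cut d E' hE') := by
  induction h using Relation.ReflTransGen.head_induction_on with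
  | refl => exact Relation.ReflTransGen.refl
  | head h _ ih =>
    obtain ⟨σ, F₁, F₂, τ, hσ, hσE, hne, hF₁, hF₂, h₁, h₂, hτ, hτd, hlink⟩ := h
    have hB' : K.ConnectedBy d (insert σ _) := hE.mono (Set.subset_insert σ _)
    refine (ih ?_ hB').head
      (isTLCGluing_cut hK hdim hE hσ hσE hne hF₁ hF₂ h₁ h₂ hτ hτd hlink hB')
    rintro ρ (rfl | hρ)
    exacts [hσ, hdim ρ hρ]

/-- If any two facets through a face are joined in its star by ridges from `E`, gluing the facets
along the ridges in `E` gives back `K`. -/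
noncomputable def cutIso (E : Set K.Face) (hE : K.ConnectedBy d E) (hpure : K.IsPure d ⊤)
    (hnormal : ∀ G F F' : K.Face, K.dim F = d → K.dim F' = d → G ≤ F → G ≤ F' →
      K.Link d E G F F') : (K.cut d E hE).Face ≃o K.Face := by
  refine RelIso.ofSurjective (OrderEmbedding.ofMapLEIff CutFace.face ?_) ?_
  · intro x y
    induction x using CutFace.ind with | h G F hG hF =>
    induction y using CutFace.ind with | h G' F' hG' hF' =>
    rw [CutFace.mk_le_mk]
    exact ⟨fun h => ⟨h, hnormal G F F' hF hF' hG (le_trans h hG')⟩, fun h => h.1⟩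
  · intro G
    obtain ⟨F, -, hF, hG⟩ := hpure.exists_ge (G := G) trivial
    exact ⟨CutFace.mk E hG hF, rfl⟩

/-! ### Weakly constructible complexes -/

/-- Any two `e`-faces of `C` are joined by `e`-faces of `C`, successive ones sharing a face of
dimension at least `s`. -/
def IsLinked (K : SimplicialCW) (e s : ℤ) (C : LowerSet K.Face) : Prop :=
  ∀ σ σ' : K.Face, σ ∈ C → K.dim σ = e → σ' ∈ C → K.dim σ' = e →
    Relation.ReflTransGen
      (fun a b => b ∈ C ∧ K.dim b = e ∧ ∃ τ, τ ≤ a ∧ τ ≤ b ∧ s ≤ K.dim τ) σ σ'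

/-- Complexes built from `d`-simplices by successive unions of two pieces whose intersection is pure
of dimension `d - 1` with any two ridges joined through faces of dimension at least `d - 1 - t`.
This weakens `t`-constructibility: the intersection may have cohomology. -/
inductive IsWeaklyConstructible (K : SimplicialCW) (d t : ℕ) : LowerSet K.Face → Prop
  | simplex (F : K.Face) (hF : K.dim F = d) : IsWeaklyConstructible K d t (LowerSet.Iic F)
  | union (C₁ C₂ : LowerSet K.Face) (h₁ : IsWeaklyConstructible K d t C₁)
      (h₂ : IsWeaklyConstructible K d t C₂) (hpure : K.IsPure ((d : ℤ) - 1) (C₁ ⊓ C₂))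
      (hlink : K.IsLinked ((d : ℤ) - 1) ((d : ℤ) - 1 - t) (C₁ ⊓ C₂)) :
      IsWeaklyConstructible K d t (C₁ ⊔ C₂)

theorem IsWeaklyConstructible.isPure {C : LowerSet K.Face} (h : K.IsWeaklyConstructible d t C) :
    K.IsPure d C := by
  induction h with
  | simplex F hF => exact isPure_Iic hF
  | union _ _ _ _ _ _ ih₁ ih₂ => exact ih₁.sup ih₂

/-- The ridges lying in two facets of `C`. -/
def interiorRidges (K : SimplicialCW) (d : ℕ) (C : LowerSet K.Face) : Set K.Face :=
  {σ | K.dim σ = (d : ℤ) - 1 ∧ ∃ F₁ ∈ C, ∃ F₂ ∈ C, F₁ ≠ F₂ ∧ K.dim F₁ = d ∧ K.dim F₂ = d ∧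
    σ ≤ F₁ ∧ σ ≤ F₂}

/-- The facets of `C`. -/
def facets (K : SimplicialCW) (d : ℕ) (C : LowerSet K.Face) : Set K.Face :=
  {F | F ∈ C ∧ K.dim F = d}

theorem interiorRidges_mono {C D : LowerSet K.Face} (h : C ≤ D) :
    K.interiorRidges d C ⊆ K.interiorRidges d D := by
  rintro σ ⟨hσ, F₁, hF₁, F₂, hF₂, h'⟩
  exact ⟨hσ, F₁, h hF₁, F₂, h hF₂, h'⟩

/-- A ridge common to two pieces whose intersection contains no facet lies in one facet of each. -/
theorem exists_facets_of_mem_inf {C₁ C₂ : LowerSet K.Face} (h₁ : K.IsPure d C₁)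
    (h₂ : K.IsPure d C₂) (hpure : K.IsPure ((d : ℤ) - 1) (C₁ ⊓ C₂)) {σ : K.Face}
    (hσ : σ ∈ C₁ ⊓ C₂) :
    ∃ F₁ ∈ C₁, ∃ F₂ ∈ C₂, F₁ ≠ F₂ ∧ K.dim F₁ = d ∧ K.dim F₂ = d ∧ σ ≤ F₁ ∧ σ ≤ F₂ := by
  obtain ⟨F₁, hF₁, hd₁, hle₁⟩ := h₁.exists_ge hσ.1
  obtain ⟨F₂, hF₂, hd₂, hle₂⟩ := h₂.exists_ge hσ.2
  refine ⟨F₁, hF₁, F₂, hF₂, ?_, hd₁, hd₂, hle₁, hle₂⟩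
  rintro rfl
  have := hpure.dim_le ⟨hF₁, hF₂⟩
  omega

theorem interiorRidges_sup {C₁ C₂ : LowerSet K.Face}
    (h₁ : K.IsPure d C₁) (h₂ : K.IsPure d C₂) (hpure : K.IsPure ((d : ℤ) - 1) (C₁ ⊓ C₂)) :
    K.interiorRidges d (C₁ ⊔ C₂) = K.interiorRidges d C₁ ∪ K.interiorRidges d C₂ ∪
      {σ | σ ∈ C₁ ⊓ C₂ ∧ K.dim σ = (d : ℤ) - 1} := by
  apply subset_antisymm
  · rintro σ ⟨hσ, F₁, hF₁, F₂, hF₂, hne, hd₁, hd₂, hle₁, hle₂⟩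
    rcases hF₁ with hF₁ | hF₁ <;> rcases hF₂ with hF₂ | hF₂
    · exact Or.inl (Or.inl ⟨hσ, F₁, hF₁, F₂, hF₂, hne, hd₁, hd₂, hle₁, hle₂⟩)
    · exact Or.inr ⟨⟨C₁.lower hle₁ hF₁, C₂.lower hle₂ hF₂⟩, hσ⟩
    · exact Or.inr ⟨⟨C₁.lower hle₂ hF₂, C₂.lower hle₁ hF₁⟩, hσ⟩
    · exact Or.inl (Or.inr ⟨hσ, F₁, hF₁, F₂, hF₂, hne, hd₁, hd₂, hle₁, hle₂⟩)
  · rintro σ ((hσ | hσ) | ⟨hσ, hd⟩)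
    · exact interiorRidges_mono le_sup_left hσ
    · exact interiorRidges_mono le_sup_right hσ
    · obtain ⟨F₁, hF₁, F₂, hF₂, h⟩ := exists_facets_of_mem_inf h₁ h₂ hpure hσ
      exact ⟨hd, F₁, Or.inl hF₁, F₂, Or.inr hF₂, h⟩

/-- The star of every face of a weakly constructible complex is connected through interior
ridges. -/
theorem IsWeaklyConstructible.link {C : LowerSet K.Face}
    (h : K.IsWeaklyConstructible d t C) {G F F' : K.Face} (hF : F ∈ C) (hF' : F' ∈ C)
    (hd : K.dim F = d) (hd' : K.dim F' = d) (hG : G ≤ F) (hG' : G ≤ F') :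
    K.Link d (K.interiorRidges d C) G F F' := by
  induction h generalizing F F' with
  | simplex F₀ hF₀ =>
    have h1 : F = F₀ := eq_of_le_of_dim_le hF (by omega)
    have h2 : F' = F₀ := eq_of_le_of_dim_le hF' (by omega)
    rw [h1, h2]
    exact Relation.ReflTransGen.refl
  | union C₁ C₂ h₁ h₂ hpure hlink ih₁ ih₂ =>
    have m₁ := interiorRidges_mono (K := K) (d := d) (le_sup_left : C₁ ≤ C₁ ⊔ C₂)
    have m₂ := interiorRidges_mono (K := K) (d := d) (le_sup_right : C₂ ≤ C₁ ⊔ C₂)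
    have cross : ∀ F F', F ∈ C₁ → F' ∈ C₂ → K.dim F = d → K.dim F' = d → G ≤ F → G ≤ F' →
        K.Link d (K.interiorRidges d (C₁ ⊔ C₂)) G F F' := by
      intro F F' hF hF' hd hd' hG hG'
      obtain ⟨σ, hσ, hσd, hGσ⟩ :=
        hpure.exists_ge (G := G) ⟨C₁.lower hG hF, C₂.lower hG' hF'⟩
      obtain ⟨F₁, hF₁, F₂, hF₂, hne, hd₁, hd₂, hle₁, hle₂⟩ :=
        exists_facets_of_mem_inf h₁.isPure h₂.isPure hpure hσ
      have hmem : σ ∈ K.interiorRidges d (C₁ ⊔ C₂) :=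
        ⟨hσd, F₁, Or.inl hF₁, F₂, Or.inr hF₂, hne, hd₁, hd₂, hle₁, hle₂⟩
      exact ((ih₁ hF hF₁ hd hd₁ hG (hGσ.trans hle₁)).mono m₁ le_rfl).trans
        ((Link.single hd₁ hd₂ hmem hGσ hle₁ hle₂).trans
          ((ih₂ hF₂ hF' hd₂ hd' (hGσ.trans hle₂) hG').mono m₂ le_rfl))
    rcases hF with hF | hF <;> rcases hF' with hF' | hF'
    · exact (ih₁ hF hF' hd hd' hG hG').mono m₁ le_rfl
    · exact cross F F' hF hF' hd hd' hG hG'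
    · exact (cross F' F hF' hF hd' hd hG' hG).symm
    · exact (ih₂ hF hF' hd hd' hG hG').mono m₂ le_rfl

/-- Two dual trees on disjoint sets of facets are joined along a ridge to a dual tree. -/
theorem IsDualTree.join {F₀ F₁ F₂ σ : K.Face} {A₁ T₁ : Set K.Face}
    {p : Set K.Face × Set K.Face} (h₁ : K.IsDualTree d F₀ (A₁, T₁)) (h₂ : K.IsDualTree d F₂ p)
    (hdisj : Disjoint A₁ p.1) (hF₁ : F₁ ∈ A₁) (hF₂ : K.dim F₂ = d)
    (hσ : K.dim σ = (d : ℤ) - 1) (hle₁ : σ ≤ F₁) (hle₂ : σ ≤ F₂) :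
    K.IsDualTree d F₀ (A₁ ∪ p.1, insert σ (T₁ ∪ p.2)) := by
  induction h₂ with
  | refl =>
    rw [Set.union_empty, Set.union_singleton]
    exact h₁.tail
      (Attach.mk _ _ σ F₁ F₂ hF₁ (Set.disjoint_singleton_right.1 hdisj) hF₂ hσ hle₁ hle₂)
  | tail h hpq ih =>
    obtain ⟨A, T, ρ, F, F', hF, hF', hFd', hρ, hρF, hρF'⟩ := hpq
    have hdisj' : Disjoint A₁ A := hdisj.mono_right (Set.subset_insert _ _)
    have hA₁ : F' ∉ A₁ := fun h => Set.disjoint_left.1 hdisj h (Set.mem_insert _ _)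
    have key := (ih hdisj').tail (Attach.mk _ _ ρ F F' (Or.inr hF)
      (by rintro (h | h) <;> contradiction) hFd' hρ hρF hρF')
    rwa [Set.union_insert, Set.union_insert, Set.insert_comm]

/-- The common ridges of two pieces can be glued one after the other as soon as one of them is
glued. -/
theorem reach_of_isLinked {C₁ C₂ : LowerSet K.Face}
    (h₁ : K.IsWeaklyConstructible d t C₁) (h₂ : K.IsWeaklyConstructible d t C₂)
    (hpure : K.IsPure ((d : ℤ) - 1) (C₁ ⊓ C₂))
    (hlink : K.IsLinked ((d : ℤ) - 1) ((d : ℤ) - 1 - t) (C₁ ⊓ C₂)) {σ₀ : K.Face}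
    (hσ₀ : σ₀ ∈ C₁ ⊓ C₂) (hd₀ : K.dim σ₀ = (d : ℤ) - 1) {E : Set K.Face}
    (hE : K.interiorRidges d C₁ ∪ K.interiorRidges d C₂ ∪ {σ₀} ⊆ E)
    (hE' : E ⊆ K.interiorRidges d (C₁ ⊔ C₂)) :
    K.Reach d t E (K.interiorRidges d (C₁ ⊔ C₂)) := by
  obtain ⟨M, -, hM⟩ := Set.Finite.exists_le_maximal
    (s := {B | K.Reach d t E B ∧ B ⊆ K.interiorRidges d (C₁ ⊔ C₂)}) (Set.toFinite _)
    (a := E) ⟨Relation.ReflTransGen.refl, hE'⟩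
  obtain ⟨hEM, hMsub⟩ := hM.1
  have hsubM := hE.trans hEM.subset
  suffices hall : ∀ σ ∈ C₁ ⊓ C₂, K.dim σ = (d : ℤ) - 1 → σ ∈ M by
    have : M = K.interiorRidges d (C₁ ⊔ C₂) := by
      refine subset_antisymm hMsub ?_
      rw [interiorRidges_sup h₁.isPure h₂.isPure hpure]
      rintro σ (hσ | ⟨hσ, hd⟩)
      · exact hsubM (Or.inl hσ)
      · exact hall σ hσ hd
    rwa [← this]
  intro σ hσ hd
  have key := hlink σ₀ σ hσ₀ hd₀ hσ hd
  clear hd hσ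
  have : σ ∈ M ∧ σ ∈ C₁ ⊓ C₂ := by
    induction key with
    | refl => exact ⟨hsubM (Or.inr rfl), hσ₀⟩
    | @tail a b _ hab ih =>
      obtain ⟨haM, ha⟩ := ih
      obtain ⟨hb, hbd, τ, hτa, hτb, hτ⟩ := hab
      refine ⟨?_, hb⟩
      by_contra hbM
      obtain ⟨A₁, hA₁, A₂, hA₂, -, hdA₁, hdA₂, hleA₁, hleA₂⟩ :=
        exists_facets_of_mem_inf h₁.isPure h₂.isPure hpure ha
      obtain ⟨B₁, hB₁, B₂, hB₂, hne, hdB₁, hdB₂, hleB₁, hleB₂⟩ :=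
        exists_facets_of_mem_inf h₁.isPure h₂.isPure hpure hb
      -- `τ` joins `B₁` to `A₁` inside `C₁`, then `A₁` to `A₂` across `a`, then `A₂` to `B₂`.
      have hl : K.Link d M τ B₁ B₂ :=
        ((h₁.link hB₁ hA₁ hdB₁ hdA₁ (hτb.trans hleB₁) (hτa.trans hleA₁)).mono
          (fun x hx => hsubM (Or.inl (Or.inl hx))) le_rfl).trans
        ((Link.single hdA₁ hdA₂ haM hτa hleA₁ hleA₂).trans
          ((h₂.link hA₂ hB₂ hdA₂ hdB₂ (hτa.trans hleA₂) (hτb.trans hleB₂)).mono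
            (fun x hx => hsubM (Or.inl (Or.inr hx))) le_rfl))
      have hstep := GlueStep.mk M b B₁ B₂ τ hbd hbM hne hdB₁ hdB₂ hleB₁ hleB₂ hτb hτ hl
      have hmem : b ∈ K.interiorRidges d (C₁ ⊔ C₂) :=
        ⟨hbd, B₁, Or.inl hB₁, B₂, Or.inr hB₂, hne, hdB₁, hdB₂, hleB₁, hleB₂⟩
      have := hM.2 ⟨hEM.tail hstep, Set.insert_subset hmem hMsub⟩ (Set.subset_insert _ _)
      exact hbM (this (Set.mem_insert _ _))
  exact this.1

/-- From every root, a weakly constructible complex has a spanning dual tree such that all other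
interior ridges can be glued one after the other. -/
theorem IsWeaklyConstructible.exists_isDualTree {C : LowerSet K.Face}
    (h : K.IsWeaklyConstructible d t C) {F₀ : K.Face} (hF₀ : F₀ ∈ C) (hd₀ : K.dim F₀ = d) :
    ∃ T, K.IsDualTree d F₀ (K.facets d C, T) ∧ K.Reach d t T (K.interiorRidges d C) := by
  induction h generalizing F₀ with
  | simplex F hF =>
    obtain rfl : F₀ = F := eq_of_le_of_dim_le hF₀ (by omega)
    have h1 : K.facets d (LowerSet.Iic F₀) = {F₀} := by
      ext G
      exact ⟨fun h => eq_of_le_of_dim_le h.1 (by rw [h.2, hF]), by rintro rfl; exact ⟨le_rfl, hF⟩⟩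
    have h2 : K.interiorRidges d (LowerSet.Iic F₀) = ∅ := by
      refine Set.eq_empty_of_forall_notMem ?_
      rintro σ ⟨-, F₁, hF₁, F₂, hF₂, hne, hd₁, hd₂, -⟩
      exact hne ((eq_of_le_of_dim_le hF₁ (by omega)).trans
        (eq_of_le_of_dim_le hF₂ (by omega)).symm)
    rw [h1, h2]
    exact ⟨∅, Relation.ReflTransGen.refl, Relation.ReflTransGen.refl⟩
  | union C₁ C₂ h₁ h₂ hpure hlink ih₁ ih₂ =>
    obtain ⟨σ, hσ, hσd, -⟩ := hpure.exists_ge hpure.1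
    obtain ⟨F₁, hF₁, F₂, hF₂, hne, hd₁, hd₂, hle₁, hle₂⟩ :=
      exists_facets_of_mem_inf h₁.isPure h₂.isPure hpure hσ
    have hdisj : Disjoint (K.facets d C₁) (K.facets d C₂) := by
      refine Set.disjoint_left.2 fun F hF hF' => ?_
      have := hpure.dim_le (G := F) ⟨hF.1, hF'.1⟩
      have := hF.2
      omega
    have hfac : K.facets d (C₁ ⊔ C₂) = K.facets d C₁ ∪ K.facets d C₂ := by
      ext F
      exact or_and_right
    have hreach : ∀ T₁ T₂, K.Reach d t T₁ (K.interiorRidges d C₁) →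
        K.Reach d t T₂ (K.interiorRidges d C₂) →
        K.Reach d t (insert σ (T₁ ∪ T₂)) (K.interiorRidges d (C₁ ⊔ C₂)) := by
      intro T₁ T₂ r₁ r₂
      have r₁' := r₁.union (T₂ ∪ {σ})
      have r₂' := r₂.union (K.interiorRidges d C₁ ∪ {σ})
      have e₁ : insert σ (T₁ ∪ T₂) = T₁ ∪ (T₂ ∪ {σ}) := by
        ext x; simp only [Set.mem_insert_iff, Set.mem_union, Set.mem_singleton_iff]; tauto
      have e₂ : K.interiorRidges d C₁ ∪ (T₂ ∪ {σ}) = T₂ ∪ (K.interiorRidges d C₁ ∪ {σ}) := by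
        ext x; simp only [Set.mem_union, Set.mem_singleton_iff]; tauto
      rw [e₁]
      rw [e₂] at r₁'
      refine r₁'.trans (r₂'.trans (reach_of_isLinked h₁ h₂ hpure hlink hσ hσd ?_ ?_))
      · rintro x ((hx | hx) | hx)
        exacts [Or.inr (Or.inl hx), Or.inl hx, Or.inr (Or.inr hx)]
      · rw [interiorRidges_sup h₁.isPure h₂.isPure hpure]
        rintro x (hx | hx | rfl)
        exacts [Or.inl (Or.inr hx), Or.inl (Or.inl hx), Or.inr ⟨hσ, hσd⟩]
    rcases hF₀ with hF₀ | hF₀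
    · obtain ⟨T₁, t₁, r₁⟩ := ih₁ hF₀ hd₀
      obtain ⟨T₂, t₂, r₂⟩ := ih₂ hF₂ hd₂
      refine ⟨insert σ (T₁ ∪ T₂), ?_, hreach T₁ T₂ r₁ r₂⟩
      rw [hfac]
      exact t₁.join t₂ hdisj ⟨hF₁, hd₁⟩ hd₂ hσd hle₁ hle₂
    · obtain ⟨T₁, t₁, r₁⟩ := ih₁ hF₁ hd₁
      obtain ⟨T₂, t₂, r₂⟩ := ih₂ hF₀ hd₀
      refine ⟨insert σ (T₁ ∪ T₂), ?_, hreach T₁ T₂ r₁ r₂⟩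
      rw [hfac, Set.union_comm, Set.union_comm T₁]
      exact t₂.join t₁ hdisj.symm ⟨hF₂, hd₂⟩ hd₁ hσd hle₂ hle₁

theorem IsDualTree.link {F₀ : K.Face} (h₀ : K.dim F₀ = d) {p : Set K.Face × Set K.Face}
    (h : K.IsDualTree d F₀ p) {F : K.Face} (hF : F ∈ p.1) :
    K.dim F = d ∧ K.Link d p.2 ⊥ F₀ F := by
  induction h generalizing F with
  | refl =>
    obtain rfl := Set.mem_singleton_iff.1 hF
    exact ⟨h₀, Relation.ReflTransGen.refl⟩
  | tail _ hpq ih =>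
    obtain ⟨A, T, ρ, X, X', hX, hX', hXd', hρ, hρX, hρX'⟩ := hpq
    have hl := fun {F} hF => ((ih (F := F) hF).2.mono (Set.subset_insert ρ _) le_rfl)
    rcases hF with rfl | hF
    · exact ⟨hXd', (hl hX).trans
        (Link.single (ih hX).1 hXd' (Set.mem_insert _ _) bot_le hρX hρX')⟩
    · exact ⟨(ih hF).1, hl hF⟩

/-- Weakly constructible pseudomanifolds are `t`-LC. -/
theorem IsWeaklyConstructible.isTLC (hK : K.IsPseudomanifold d)
    (h : K.IsWeaklyConstructible d t ⊤) : K.IsTLC d t := by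
  refine ⟨hK, ?_⟩
  obtain ⟨F₀, -, hd₀, -⟩ := hK.1.exists_ge hK.1.1
  obtain ⟨T, hT, hr⟩ := h.exists_isDualTree (F₀ := F₀) trivial hd₀
  have hfac : K.facets d ⊤ = {F | K.dim F = d} := by
    ext F
    exact and_iff_right trivial
  rw [hfac] at hT
  have hcT : K.ConnectedBy d T :=
    ⟨⟨F₀, hd₀⟩, fun F F' hF hF' =>
      ((hT.link hd₀ (F := F) hF).2.symm).trans (hT.link hd₀ (F := F') hF').2⟩
  have hcE : K.ConnectedBy d (K.interiorRidges d ⊤) := hcT.mono hr.subset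
  refine HasTLocalConstruction.of_iso (cutIso (K.interiorRidges d ⊤) hcE hK.1 ?_)
    ⟨K.cut d T hcT, hT.isTreeOfSimplices hK hd₀ hcT, hr.cut hK ?_ hcT hcE⟩
  · intro G F F' hF hF' hG hG'
    exact h.link trivial trivial hF hF' hG hG'
  · exact fun ρ hρ => (hr.subset hρ).1

/-! ### `t`-constructible complexes are weakly constructible -/

theorem IsConstructible.isPure {C : LowerSet K.Face} {k : ℕ} (h : K.IsConstructible k C) :
    K.IsPure k C := by
  induction h with
  | simplex d F hF => exact isPure_Iic hF
  | zero C hC => exact hC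
  | union d C₁ C₂ _ _ _ ih₁ ih₂ _ => exact ih₁.sup ih₂

/-- A constructible complex is strongly connected. -/
theorem IsConstructible.isLinked {C : LowerSet K.Face} {k : ℕ} (h : K.IsConstructible k C) :
    K.IsLinked k ((k : ℤ) - 1) C := by
  induction h with
  | simplex d F hF =>
    intro σ σ' hσ hσd hσ' hσd'
    have h1 : σ = F := eq_of_le_of_dim_le hσ (by omega)
    have h2 : σ' = F := eq_of_le_of_dim_le hσ' (by omega)
    rw [h1, h2]
  | zero C hC =>
    intro σ σ' _ _ hσ' hσd'
    exact Relation.ReflTransGen.single ⟨hσ', hσd', ⊥, bot_le, bot_le, by rw [dim_bot]; simp⟩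
  | union d C₁ C₂ h₁ h₂ h ih₁ ih₂ _ =>
    obtain ⟨τ, hτ, hτd, -⟩ := h.isPure.exists_ge h.isPure.1
    obtain ⟨F₁, hF₁, hd₁, hle₁⟩ := h₁.isPure.exists_ge hτ.1
    obtain ⟨F₂, hF₂, hd₂, hle₂⟩ := h₂.isPure.exists_ge hτ.2
    have mono : ∀ {D : LowerSet K.Face} {x y : K.Face}, D ≤ C₁ ⊔ C₂ →
        Relation.ReflTransGen (fun a b => b ∈ D ∧ K.dim b = ((d + 1 : ℕ) : ℤ) ∧
          ∃ τ, τ ≤ a ∧ τ ≤ b ∧ ((d + 1 : ℕ) : ℤ) - 1 ≤ K.dim τ) x y →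
        Relation.ReflTransGen (fun a b => b ∈ C₁ ⊔ C₂ ∧ K.dim b = ((d + 1 : ℕ) : ℤ) ∧
          ∃ τ, τ ≤ a ∧ τ ≤ b ∧ ((d + 1 : ℕ) : ℤ) - 1 ≤ K.dim τ) x y := fun hD h =>
      Relation.ReflTransGen.mono (fun _ _ h => ⟨hD h.1, h.2⟩) _ _ h
    have hτd' : ((d + 1 : ℕ) : ℤ) - 1 ≤ K.dim τ := by push_cast; omega
    intro σ σ' hσ hσd hσ' hσd'
    rcases hσ with hσ | hσ <;> rcases hσ' with hσ' | hσ'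
    · exact mono le_sup_left (ih₁ σ σ' hσ hσd hσ' hσd')
    · exact ((mono le_sup_left (ih₁ σ F₁ hσ hσd hF₁ hd₁)).tail
        ⟨Or.inr hF₂, hd₂, τ, hle₁, hle₂, hτd'⟩).trans
        (mono le_sup_right (ih₂ F₂ σ' hF₂ hd₂ hσ' hσd'))
    · exact ((mono le_sup_right (ih₂ σ F₂ hσ hσd hF₂ hd₂)).tail
        ⟨Or.inl hF₁, hd₁, τ, hle₂, hle₁, hτd'⟩).trans
        (mono le_sup_left (ih₁ F₁ σ' hF₁ hd₁ hσ' hσd'))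
    · exact mono le_sup_right (ih₂ σ σ' hσ hσd hσ' hσd')

/-- If the `k`-skeleton of a pure complex is constructible, its facets are joined through
`(k-1)`-faces. -/
theorem IsConstructible.isLinked_of_skeleton {C : LowerSet K.Face} {k : ℕ} {e : ℤ} (hke : k ≤ e)
    (hC : K.IsPure e C) (h : K.IsConstructible k (K.skeleton k C)) :
    K.IsLinked e ((k : ℤ) - 1) C := by
  intro σ σ' hσ hσd hσ' hσd'
  obtain ⟨ρ, hρ, hρd⟩ := exists_le_dim_eq σ (n := k) (by omega) (by omega)
  obtain ⟨ρ', hρ', hρd'⟩ := exists_le_dim_eq σ' (n := k) (by omega) (by omega)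
  have key := h.isLinked ρ ρ' ⟨C.lower hρ hσ, hρd.le⟩ hρd ⟨C.lower hρ' hσ', hρd'.le⟩ hρd'
  have : ∀ x, ρ' ≤ x → x ∈ C → K.dim x = e →
      Relation.ReflTransGen
        (fun a b => b ∈ C ∧ K.dim b = e ∧ ∃ τ, τ ≤ a ∧ τ ≤ b ∧ (k : ℤ) - 1 ≤ K.dim τ) σ x := by
    clear hρ' hρd'
    induction key with
    | refl =>
      intro x hx hxC hxd
      exact Relation.ReflTransGen.single ⟨hxC, hxd, ρ, hρ, hx, by omega⟩
    | @tail a b hρa hab ih =>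
      intro x hx hxC hxd
      obtain ⟨hb, hbd, τ, hτa, hτb, hτ⟩ := hab
      have haC : a ∈ C := by
        rcases Relation.ReflTransGen.cases_tail hρa with h | ⟨_, -, h⟩
        · exact h ▸ C.lower hρ hσ
        · exact h.1.1
      obtain ⟨y, hy, hyd, hay⟩ := hC.exists_ge haC
      exact (ih y hay hy hyd).tail ⟨hxC, hxd, τ, hτa.trans hay, hτb.trans hx, hτ⟩
  exact this σ' hρ' hσ' hσd'

/-- Connected `1`-complexes are weakly constructible: edges can be added one at a time, each
meeting the previous ones in one or two vertices. -/
theorem isWeaklyConstructible_of_connected (ht : 1 ≤ t) {C : LowerSet K.Face} (hC : K.IsPure 1 C)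
    (hconn : K.IsConnectedComplex C) : K.IsWeaklyConstructible 1 t C := by
  obtain ⟨F₀, hF₀, hd₀, -⟩ := hC.exists_ge hC.1
  have : Finite (LowerSet K.Face) := Finite.of_injective (fun D => (D : Set K.Face))
    SetLike.coe_injective
  obtain ⟨M, hM₀, hM⟩ := Set.Finite.exists_le_maximal
    (s := {D : LowerSet K.Face | K.IsWeaklyConstructible 1 t D ∧ D ≤ C}) (Set.toFinite _)
    (a := LowerSet.Iic F₀) ⟨IsWeaklyConstructible.simplex F₀ hd₀, LowerSet.Iic_le.2 hF₀⟩
  obtain ⟨hMw, hMC⟩ := hM.1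
  -- an edge touching `M` belongs to `M`, for otherwise it could be added to `M`
  have hedge : ∀ e ∈ C, K.dim e = 1 → ∀ v ∈ M, IsAtom v → v ≤ e → e ∈ M := by
    intro e he hed v hv hva hve
    by_contra heM
    have hatom : ∀ w : K.Face, IsAtom w → K.dim w = 0 := by
      intro w hw
      have h1 := dim_lt (bot_lt_iff_ne_bot.2 hw.1)
      rw [dim_bot] at h1
      by_contra hne
      obtain ⟨u, huw, hu⟩ := exists_le_dim_eq w (n := 0) (by omega) (by omega)
      rcases hw.le_iff.1 huw with rfl | rfl
      · rw [dim_bot] at hu; omega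
      · exact hne hu
    have hpure : K.IsPure (((1 : ℕ) : ℤ) - 1) (M ⊓ LowerSet.Iic e) := by
      refine isPure_of ⟨hMw.isPure.1, bot_le⟩ ?_
      rintro G ⟨hG, hGe⟩
      by_cases hGb : G = ⊥
      · exact ⟨v, ⟨hv, hve⟩, by rw [hatom v hva]; simp, hGb ▸ bot_le⟩
      · refine ⟨G, ⟨hG, hGe⟩, ?_, le_rfl⟩
        have h1 := dim_lt (bot_lt_iff_ne_bot.2 hGb)
        rw [dim_bot] at h1
        have hlt : G < e := lt_of_le_of_ne hGe fun h => heM (h ▸ hG)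
        have h2 := dim_lt hlt
        push_cast
        omega
    have hlink : K.IsLinked (((1 : ℕ) : ℤ) - 1) (((1 : ℕ) : ℤ) - 1 - t) (M ⊓ LowerSet.Iic e) :=
      fun σ σ' _ _ hσ' hσd' => Relation.ReflTransGen.single
        ⟨hσ', hσd', ⊥, bot_le, bot_le, by rw [dim_bot]; push_cast; omega⟩
    have hmem := hM.2 ⟨IsWeaklyConstructible.union M _ hMw
      (IsWeaklyConstructible.simplex e (by rw [hed]; simp)) hpure hlink,
      sup_le hMC (LowerSet.Iic_le.2 he)⟩ le_sup_left
    exact heM (hmem (Or.inr (LowerSet.mem_Iic_iff.2 le_rfl)))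
  have hvert : ∀ e : K.Face, K.dim e = 1 → ∃ v, IsAtom v ∧ v ≤ e := by
    intro e he
    have hne : e ≠ ⊥ := by rintro rfl; rw [dim_bot] at he; omega
    obtain ⟨v, hv, hve⟩ := (IsAtomic.eq_bot_or_exists_atom_le e).resolve_left hne
    exact ⟨v, hv, hve⟩
  obtain ⟨v₀, hv₀, hv₀F⟩ := hvert F₀ hd₀
  have hv₀M : v₀ ∈ M := hM₀ hv₀F
  have hall : ∀ w, IsAtom w → w ∈ C → w ∈ M := by
    intro w hw hwC
    have h := hconn v₀ w hv₀ (hMC hv₀M) hw hwC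
    clear hw hwC
    induction h with
    | refl => exact hv₀M
    | tail _ hab ih =>
      obtain ⟨ha, -, e, he, hed, hae, hbe⟩ := hab
      exact M.lower hbe (hedge e he hed _ ih ha hae)
  have : C = M := by
    refine le_antisymm ?_ hMC
    intro G hG
    obtain ⟨e, he, hed, hGe⟩ := hC.exists_ge hG
    obtain ⟨v, hv, hve⟩ := hvert e hed
    exact M.lower hGe (hedge e he hed v (hall v hv (C.lower hve he)) hv hve)
  rwa [this]

theorem IsTConstructibleSub.isWeaklyConstructible (ht : 1 ≤ t) {C : LowerSet K.Face}
    (h : K.IsTConstructibleSub d t C) : K.IsWeaklyConstructible d t C := by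
  induction h with
  | simplex F hF => exact IsWeaklyConstructible.simplex F hF
  | connected C hd hC hconn =>
    subst hd
    exact isWeaklyConstructible_of_connected ht hC hconn
  | union C₁ C₂ k hk _ _ hpure hskel ih₁ ih₂ =>
    refine IsWeaklyConstructible.union C₁ C₂ ih₁ ih₂ hpure ?_
    have := hskel.isLinked_of_skeleton (by omega) hpure
    have hs : (d : ℤ) - 1 - t = (k : ℤ) - 1 := by omega
    rwa [hs]

/-! ### Cohomology with coefficients modulo 2 -/

/-- The coboundary modulo 2: the sum of the values on the faces of codimension one. -/
noncomputable def coboundary (K : SimplicialCW) (f : K.Face → ZMod 2) (F : K.Face) : ZMod 2 :=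
  ∑ G ∈ (Set.toFinite {G : K.Face | G ≤ F ∧ K.dim G + 1 = K.dim F}).toFinset, f G

theorem coboundary_congr {f g : K.Face → ZMod 2} {F : K.Face} (h : ∀ G ≤ F, f G = g G) :
    K.coboundary f F = K.coboundary g F :=
  Finset.sum_congr rfl fun G hG => h G ((Set.Finite.mem_toFinset _).1 hG).1

theorem coboundary_add (f g : K.Face → ZMod 2) (F : K.Face) :
    K.coboundary (fun G => f G + g G) F = K.coboundary f F + K.coboundary g F :=
  Finset.sum_add_distrib

/-- In Boolean coordinates, the faces of codimension one are obtained by deleting one vertex. -/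
theorem coboundary_symm_iso {F : K.Face} {k : ℕ} (e : Set.Iic F ≃o Finset (Fin k))
    (f : K.Face → ZMod 2) (s : Finset (Fin k)) :
    K.coboundary f (e.symm s) = ∑ i ∈ s, f (e.symm (s.erase i)) := by
  have hdim : ∀ u, K.dim (e.symm u) = (u.card : ℤ) - 1 := fun u => by
    rw [dim_eq_card_of_iso e, e.apply_symm_apply]
  symm
  refine Finset.sum_nbij (fun i => ((e.symm (s.erase i) : Set.Iic F) : K.Face)) ?_ ?_ ?_ ?_
  · intro i hi
    rw [Set.Finite.mem_toFinset]
    refine ⟨e.symm.monotone (Finset.erase_subset i s), ?_⟩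
    rw [hdim, hdim, Finset.card_erase_of_mem hi]
    have := Finset.card_pos.2 ⟨i, hi⟩
    omega
  · intro i hi j hj hij
    have h := e.symm.injective (Subtype.ext hij)
    exact (Finset.erase_inj s hi).1 h
  · intro G hG
    rw [Finset.mem_coe, Set.Finite.mem_toFinset] at hG
    obtain ⟨hle, hd⟩ := hG
    have hGF : G ≤ F := hle.trans (e.symm s).2
    have hs : e ⟨G, hGF⟩ ≤ s := by
      rw [← e.le_symm_apply]; exact hle
    have hGd := dim_eq_card_of_iso e ⟨G, hGF⟩
    rw [hdim] at hd
    simp only at hGd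
    obtain ⟨i, hi, his⟩ := Finset.exists_eq_insert_iff.2
      ⟨hs, (by omega : (e ⟨G, hGF⟩).card + 1 = s.card)⟩
    refine ⟨i, his ▸ Finset.mem_insert_self _ _, ?_⟩
    simp only [← his, Finset.erase_insert hi, e.symm_apply_apply]
  · intro i _
    rfl

theorem sum_sum_erase_erase {α : Type*} [DecidableEq α] (s : Finset α)
    (f : Finset α → ZMod 2) : ∑ i ∈ s, ∑ j ∈ s.erase i, f ((s.erase i).erase j) = 0 := by
  rw [Finset.sum_sigma']
  refine Finset.sum_involution (fun p _ => ⟨p.2, p.1⟩) ?_ ?_ ?_ ?_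
  · rintro ⟨i, j⟩ _
    rw [Finset.erase_right_comm]
    exact CharTwo.add_self_eq_zero _
  · rintro ⟨i, j⟩ h _ heq
    simp only [Finset.mem_sigma, Finset.mem_erase] at h
    simp only [Sigma.mk.injEq] at heq
    exact h.2.1 heq.1
  · rintro ⟨i, j⟩ h
    simp only [Finset.mem_sigma, Finset.mem_erase] at h ⊢
    exact ⟨h.2.2, h.2.1.symm, h.1⟩
  · rintro ⟨i, j⟩ _
    rfl

theorem coboundary_coboundary (f : K.Face → ZMod 2) (F : K.Face) :
    K.coboundary (K.coboundary f) F = 0 := by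
  obtain ⟨k, ⟨e⟩⟩ := K.boolean F
  have h := coboundary_symm_iso e (K.coboundary f) (e ⟨F, le_rfl⟩)
  simp only [e.symm_apply_apply, coboundary_symm_iso] at h
  rw [h]
  exact sum_sum_erase_erase _ fun s => f (e.symm s)

/-- The reduced cohomology of `C` modulo 2 vanishes in degree `n`. -/
def IsAcyclicAt (K : SimplicialCW) (n : ℤ) (C : LowerSet K.Face) : Prop :=
  ∀ f : K.Face → ZMod 2, (∀ F ∈ C, K.dim F = n + 1 → K.coboundary f F = 0) →
    ∃ g : K.Face → ZMod 2, ∀ F ∈ C, K.dim F = n → f F = K.coboundary g F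

/-- Simplices are acyclic: the contracting homotopy joins faces with a fixed vertex. -/
theorem isAcyclicAt_Iic {F : K.Face} (hF : 0 ≤ K.dim F) (n : ℤ) :
    K.IsAcyclicAt n (LowerSet.Iic F) := by
  classical
  intro f hf
  obtain ⟨k, ⟨e⟩⟩ := K.boolean F
  have hk := dim_eq_card_of_iso e ⟨F, le_rfl⟩
  simp only at hk
  obtain ⟨v, -⟩ : (e ⟨F, le_rfl⟩).Nonempty := Finset.card_pos.1 (by omega)
  have hdim : ∀ u, K.dim (e.symm u) = (u.card : ℤ) - 1 := fun u => by
    rw [dim_eq_card_of_iso e, e.apply_symm_apply]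
  let g : K.Face → ZMod 2 := fun G =>
    if h : G ≤ F then if v ∈ e ⟨G, h⟩ then 0 else f (e.symm (insert v (e ⟨G, h⟩))) else 0
  have hg : ∀ s, g (e.symm s) = if v ∈ s then 0 else f (e.symm (insert v s)) := by
    intro s
    have h : ((e.symm s : Set.Iic F) : K.Face) ≤ F := (e.symm s).2
    simp only [g, dif_pos h, e.apply_symm_apply]
  refine ⟨g, fun G hGF hGd => ?_⟩
  obtain ⟨s, hs⟩ := e.symm.surjective ⟨G, hGF⟩
  have hGs : G = (e.symm s : Set.Iic F) := by rw [hs]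
  rw [hGs] at hGd ⊢
  rw [coboundary_symm_iso]
  simp only [hg]
  by_cases hv : v ∈ s
  · rw [Finset.sum_eq_single v]
    · rw [if_neg (Finset.notMem_erase v s), Finset.insert_erase hv]
    · intro i _ hi
      rw [if_pos (Finset.mem_erase.2 ⟨hi.symm, hv⟩)]
    · exact fun h => absurd hv h
  · have hc := hf (e.symm (insert v s)) (e.symm (insert v s)).2 (by
      rw [hdim] at hGd ⊢
      rw [Finset.card_insert_of_notMem hv]
      push_cast
      omega)
    rw [coboundary_symm_iso, Finset.sum_insert hv, Finset.erase_insert hv,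
      CharTwo.add_eq_zero] at hc
    rw [hc]
    refine Finset.sum_congr rfl fun i hi => ?_
    have hiv : i ≠ v := fun h => hv (h ▸ hi)
    rw [if_neg fun h => hv (Finset.mem_of_mem_erase h), Finset.erase_insert_of_ne hiv.symm]

/-- Mayer–Vietoris: a union is acyclic in degree `n` if both pieces are and the intersection is
acyclic in degree `n - 1`. -/
theorem IsAcyclicAt.sup {C₁ C₂ : LowerSet K.Face} {n : ℤ} (h₁ : K.IsAcyclicAt n C₁)
    (h₂ : K.IsAcyclicAt n C₂) (h : K.IsAcyclicAt (n - 1) (C₁ ⊓ C₂)) :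
    K.IsAcyclicAt n (C₁ ⊔ C₂) := by
  classical
  intro f hf
  obtain ⟨g₁, hg₁⟩ := h₁ f fun F hF => hf F (Or.inl hF)
  obtain ⟨g₂, hg₂⟩ := h₂ f fun F hF => hf F (Or.inr hF)
  -- the difference of the two primitives is a cocycle on the intersection
  obtain ⟨u, hu⟩ := h (fun G => g₁ G + g₂ G) (by
    intro F hF hd
    rw [coboundary_add, ← hg₁ F hF.1 (by omega), ← hg₂ F hF.2 (by omega)]
    exact CharTwo.add_self_eq_zero _)
  refine ⟨fun G => if G ∈ C₁ then g₁ G + K.coboundary u G else g₂ G, ?_⟩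
  rintro F hF hd
  by_cases hF₁ : F ∈ C₁
  · rw [coboundary_congr (g := fun G => g₁ G + K.coboundary u G)
      fun G hG => if_pos (show G ∈ C₁ from C₁.lower hG hF₁), coboundary_add,
      coboundary_coboundary, add_zero]
    exact hg₁ F hF₁ hd
  · have hF₂ : F ∈ C₂ := hF.resolve_left hF₁
    rw [hg₂ F hF₂ hd]
    refine Finset.sum_congr rfl fun G hG => ?_
    obtain ⟨hGF, hGd⟩ := (Set.Finite.mem_toFinset _).1 hG
    beta_reduce
    by_cases hG₁ : G ∈ C₁
    · rw [if_pos hG₁, ← hu G ⟨hG₁, C₂.lower hGF hF₂⟩ (by omega), ← add_assoc,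
        CharTwo.add_self_eq_zero, zero_add]
    · rw [if_neg hG₁]

theorem IsConstructible.isAcyclicAt {C : LowerSet K.Face} {k : ℕ} (h : K.IsConstructible k C)
    {n : ℤ} (hn : n < k) : K.IsAcyclicAt n C := by
  induction h generalizing n with
  | simplex k F hF => exact isAcyclicAt_Iic (by omega) n
  | zero C hC =>
    intro f hf
    refine ⟨0, fun F hF hd => ?_⟩
    -- only the empty face has dimension less than `0`; its value is the coboundary at a vertex
    have := neg_one_le_dim F
    obtain rfl : n = -1 := by push_cast at hn; omega
    obtain rfl := eq_bot_of_dim hd.le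
    obtain ⟨v, hv, hvd, -⟩ := hC.exists_ge hC.1
    have h0 := hf v hv (by rw [hvd]; simp)
    have h1 : (Set.toFinite {G : K.Face | G ≤ v ∧ K.dim G + 1 = K.dim v}).toFinset = {⊥} := by
      ext G
      rw [Set.Finite.mem_toFinset, Finset.mem_singleton]
      constructor
      · rintro ⟨-, h⟩
        exact eq_bot_of_dim (by omega)
      · rintro rfl
        exact ⟨bot_le, by rw [dim_bot, hvd]; rfl⟩
    unfold coboundary at h0 ⊢
    rw [h1, Finset.sum_singleton] at h0
    rw [h0]
    simp
  | union k C₁ C₂ _ _ _ ih₁ ih₂ ih =>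
    refine IsAcyclicAt.sup (ih₁ hn) (ih₂ hn) (ih ?_)
    push_cast at hn
    omega

theorem IsTConstructibleSub.isAcyclicAt (hd : 2 ≤ d) {C : LowerSet K.Face}
    (h : K.IsTConstructibleSub d t C) {n : ℤ} (hn : n + t ≤ d) : K.IsAcyclicAt n C := by
  induction h with
  | simplex F hF => exact isAcyclicAt_Iic (by omega) n
  | connected C h1 => omega
  | union C₁ C₂ k hk _ _ _ hskel ih₁ ih₂ =>
    refine IsAcyclicAt.sup ih₁ ih₂ ?_
    intro f hf
    obtain ⟨g, hg⟩ := hskel.isAcyclicAt (n := n - 1) (by omega) f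
      fun F hF hd => hf F hF.1 hd
    exact ⟨g, fun F hF hd => hg F ⟨hF, by omega⟩ hd⟩

/-! ### Complexes of finite sets -/

section OfFinsets

variable {V : Type} [Finite V] {C : LowerSet (Finset V)} {hC : ∅ ∈ C}

/-- The faces of a member of a family of sets closed under taking subsets are its subsets. -/
noncomputable def iicIsoFinset (s : {s : Finset V // s ∈ C}) :
    Finset (Fin s.1.card) ≃o Set.Iic s := by
  let ι : Fin s.1.card ↪ V := s.1.equivFin.symm.toEmbedding.trans (Function.Embedding.subtype _)
  have hι : Finset.univ.map ι = s := by
    ext v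
    simp only [Finset.mem_map, Finset.mem_univ, true_and]
    constructor
    · rintro ⟨i, rfl⟩
      exact (s.1.equivFin.symm i).2
    · intro hv
      exact ⟨s.1.equivFin ⟨v, hv⟩, by simp [ι]⟩
  refine RelIso.ofSurjective (OrderEmbedding.ofMapLEIff
    (fun A : Finset (Fin s.1.card) => ⟨⟨A.map ι, C.lower (a := s.1) ?_ s.2⟩, ?_⟩) ?_) ?_
  · exact (Finset.map_subset_map.2 (Finset.subset_univ A)).trans_eq hι
  · exact (Finset.map_subset_map.2 (Finset.subset_univ A)).trans_eq hι
  · intro A B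
    exact Finset.map_subset_map
  · rintro ⟨⟨u, hu⟩, hus⟩
    have hus' : u ⊆ Finset.univ.map ι := by rw [hι]; exact hus
    obtain ⟨A, -, hA⟩ := Finset.subset_map_iff.1 hus'
    exact ⟨A, Subtype.ext (Subtype.ext hA.symm)⟩

/-- The simplicial complex given by a nonvoid family of vertex sets closed under taking subsets. -/
noncomputable def ofFinsets (C : LowerSet (Finset V)) (hC : ∅ ∈ C) : SimplicialCW where
  Face := {s : Finset V // s ∈ C}
  orderBot := { bot := ⟨∅, hC⟩, bot_le := fun s => Finset.empty_subset s.1 }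
  finite := have := Fintype.ofFinite V; Subtype.finite
  boolean s := ⟨s.1.card, ⟨(iicIsoFinset s).symm⟩⟩

/-- The vertex set of a face. -/
def verts (F : (ofFinsets C hC).Face) : Finset V :=
  Subtype.val (p := fun s : Finset V => s ∈ C) F

/-- The face with a given vertex set. -/
def ofVerts (hC : ∅ ∈ C) (s : Finset V) (hs : s ∈ C) : (ofFinsets C hC).Face :=
  (⟨s, hs⟩ : {s : Finset V // s ∈ C})

@[simp] theorem verts_ofVerts (s : Finset V) (hs : s ∈ C) : verts (ofVerts hC s hs) = s := rfl

theorem verts_mem (F : (ofFinsets C hC).Face) : verts F ∈ C :=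
  Subtype.property (p := fun s : Finset V => s ∈ C) F

theorem verts_subset {F G : (ofFinsets C hC).Face} : verts F ⊆ verts G ↔ F ≤ G := Iff.rfl

theorem verts_injective : Function.Injective (verts : (ofFinsets C hC).Face → Finset V) :=
  Subtype.val_injective

theorem dim_ofFinsets (F : (ofFinsets C hC).Face) :
    (ofFinsets C hC).dim F = ((verts F).card : ℤ) - 1 := by
  have hF : F ∈ Set.Iic F := Set.mem_Iic.2 le_rfl
  let e : Set.Iic F ≃o Finset (Fin (verts F).card) := (iicIsoFinset (C := C) F).symm
  have h : e ⟨F, hF⟩ = Finset.univ :=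
    Finset.univ_subset_iff.1 (e.symm_apply_le.1 (e.symm Finset.univ).2)
  have h' := dim_eq_card_of_iso e ⟨F, hF⟩
  rwa [h, Finset.card_univ, Fintype.card_fin] at h'

theorem isSimplicialComplex_ofFinsets : (ofFinsets C hC).IsSimplicialComplex := by
  intro F G h
  have key : ∀ F G : (ofFinsets C hC).Face, (∀ v, IsAtom v → (v ≤ F ↔ v ≤ G)) → F ≤ G := by
    intro F G h
    rw [← verts_subset]
    intro v hv
    have hv' : {v} ∈ C := C.lower (a := verts F) (Finset.singleton_subset_iff.2 hv) (verts_mem F)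
    have hatom : IsAtom (ofVerts hC {v} hv') := by
      rw [← bot_covBy_iff, covBy_iff_lt_and_eq_or_eq]
      refine ⟨bot_lt_iff_ne_bot.2 ?_, ?_⟩
      · intro heq
        exact Finset.singleton_ne_empty v (congrArg verts heq)
      · intro c _ hc
        rcases Finset.subset_singleton_iff.1 (verts_subset.2 hc) with h | h
        · exact Or.inl (verts_injective h)
        · exact Or.inr (verts_injective h)
    have := (h _ hatom).1 (verts_subset.1 (Finset.singleton_subset_iff.2 hv))
    exact Finset.singleton_subset_iff.1 (verts_subset.2 this)
  exact le_antisymm (key F G h) (key G F fun v hv => (h v hv).symm)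

/-- The subcomplex of `ofFinsets C hC` given by a smaller family of sets. -/
def restrict (hC : ∅ ∈ C) (D : LowerSet (Finset V)) : LowerSet (ofFinsets C hC).Face where
  carrier := {F | verts F ∈ D}
  lower' := fun _ _ hba ha => D.lower (verts_subset.2 hba) ha

theorem restrict_self : restrict hC C = ⊤ :=
  top_le_iff.1 fun F _ => verts_mem F

theorem coboundary_ofFinsets [DecidableEq V] (f : Finset V → ZMod 2)
    (F : (ofFinsets C hC).Face) :
    (ofFinsets C hC).coboundary (fun G => f (verts G)) F =
      ∑ v ∈ verts F, f ((verts F).erase v) := by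
  symm
  refine Finset.sum_bij (fun v _ => ofVerts hC ((verts F).erase v)
    (C.lower (a := verts F) (Finset.erase_subset _ _) (verts_mem F))) ?_ ?_ ?_ ?_
  · intro v hv
    rw [Set.Finite.mem_toFinset]
    refine ⟨Finset.erase_subset _ _, ?_⟩
    rw [dim_ofFinsets, dim_ofFinsets, verts_ofVerts, Finset.card_erase_of_mem hv]
    have := Finset.card_pos.2 ⟨v, hv⟩
    omega
  · intro v hv w _ h
    exact (Finset.erase_inj (verts F) hv).1 (congrArg verts h)
  · intro G hG
    obtain ⟨hle, hd⟩ := (Set.Finite.mem_toFinset _).1 hG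
    rw [dim_ofFinsets, dim_ofFinsets] at hd
    obtain ⟨v, hv, hvs⟩ := Finset.exists_eq_insert_iff.2
      ⟨verts_subset.2 hle, (by omega : (verts G).card + 1 = (verts F).card)⟩
    refine ⟨v, hvs ▸ Finset.mem_insert_self _ _, verts_injective ?_⟩
    rw [verts_ofVerts, ← hvs, Finset.erase_insert hv]
  · intro v _
    rfl

end OfFinsets

/-! ### Families of finite sets -/

section Families

variable {V : Type}

/-- A nonvoid family whose members all extend to members with `n` elements. -/
def IsPureFamily (n : ℕ) (C : LowerSet (Finset V)) : Prop :=
  ∅ ∈ C ∧ ∀ s ∈ C, ∃ σ ∈ C, σ.card = n ∧ s ⊆ σ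

/-- Members with `n` elements are joined by exchanging one element at a time. -/
def IsLinkedFamily [DecidableEq V] (n : ℕ) (C : LowerSet (Finset V)) : Prop :=
  ∀ σ σ' : Finset V, σ ∈ C → σ.card = n → σ' ∈ C → σ'.card = n →
    Relation.ReflTransGen (fun a b => b ∈ C ∧ b.card = n ∧ n ≤ (a ∩ b).card + 1) σ σ'

/-- Families built from `d`-simplices by unions along pure strongly connected families: the
combinatorial form of weak constructibility with `t = 1`. -/
inductive IsBuildable [DecidableEq V] (d : ℕ) : LowerSet (Finset V) → Prop
  | simplex (F : Finset V) (hF : F.card = d + 1) : IsBuildable d (LowerSet.Iic F)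
  | union (C₁ C₂ : LowerSet (Finset V)) (h₁ : IsBuildable d C₁) (h₂ : IsBuildable d C₂)
      (hpure : IsPureFamily d (C₁ ⊓ C₂)) (hlink : IsLinkedFamily d (C₁ ⊓ C₂)) :
      IsBuildable d (C₁ ⊔ C₂)

theorem IsPureFamily.isPure [Finite V] {C D : LowerSet (Finset V)} (hC : ∅ ∈ C) (hDC : D ≤ C)
    {n : ℕ} (hD : IsPureFamily n D) : (ofFinsets C hC).IsPure ((n : ℤ) - 1) (restrict hC D) := by
  refine isPure_of hD.1 fun G hG => ?_
  obtain ⟨σ, hσ, hcard, hle⟩ := hD.2 _ hG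
  exact ⟨ofVerts hC σ (hDC hσ), hσ, by rw [dim_ofFinsets, verts_ofVerts, hcard], hle⟩

theorem IsLinkedFamily.isLinked [DecidableEq V] [Finite V] {C D : LowerSet (Finset V)}
    (hC : ∅ ∈ C) (hDC : D ≤ C) {n : ℕ} (hD : IsLinkedFamily n D) :
    (ofFinsets C hC).IsLinked ((n : ℤ) - 1) ((n : ℤ) - 2) (restrict hC D) := by
  intro σ σ' hσ hσd hσ' hσd'
  rw [dim_ofFinsets] at hσd hσd'
  have key := hD (verts σ) (verts σ') hσ (by omega) hσ' (by omega)
  have : ∀ s, Relation.ReflTransGen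
      (fun a b => b ∈ D ∧ b.card = n ∧ n ≤ (a ∩ b).card + 1) (verts σ) s →
      ∀ x : (ofFinsets C hC).Face, verts x = s → Relation.ReflTransGen
        (fun a b => b ∈ restrict hC D ∧ (ofFinsets C hC).dim b = (n : ℤ) - 1 ∧
          ∃ τ, τ ≤ a ∧ τ ≤ b ∧ (n : ℤ) - 2 ≤ (ofFinsets C hC).dim τ) σ x := by
    intro s hs
    induction hs with
    | refl =>
      intro x hx
      rw [verts_injective hx]
    | @tail a b hσa hab ih =>
      rintro x rfl
      have haC : a ∈ C := by
        rcases Relation.ReflTransGen.cases_tail hσa with h | ⟨_, -, h⟩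
        · exact h ▸ verts_mem σ
        · exact hDC h.1
      have haux : a ∩ verts x ∈ C := C.lower (a := verts x) Finset.inter_subset_right (verts_mem x)
      refine (ih (ofVerts hC a haC) rfl).tail ⟨hab.1, ?_, ofVerts hC _ haux, ?_, ?_, ?_⟩
      · rw [dim_ofFinsets, hab.2.1]
      · exact Finset.inter_subset_left
      · exact Finset.inter_subset_right
      · rw [dim_ofFinsets, verts_ofVerts]
        omega
  exact this _ key σ' rfl

theorem IsBuildable.isWeaklyConstructible [DecidableEq V] [Finite V] (ht : 1 ≤ t)
    {C D : LowerSet (Finset V)}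
    (hC : ∅ ∈ C) (h : IsBuildable d D) (hDC : D ≤ C) :
    (ofFinsets C hC).IsWeaklyConstructible d t (restrict hC D) := by
  induction h with
  | simplex F hF =>
    refine IsWeaklyConstructible.simplex
      (ofVerts hC F (hDC (LowerSet.mem_Iic_iff.2 le_rfl))) ?_
    rw [dim_ofFinsets, verts_ofVerts, hF]
    simp
  | union C₁ C₂ _ _ hpure hlink ih₁ ih₂ =>
    refine IsWeaklyConstructible.union (restrict hC C₁) (restrict hC C₂)
      (ih₁ (le_sup_left.trans hDC)) (ih₂ (le_sup_right.trans hDC))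
      (hpure.isPure hC (inf_le_left.trans (le_sup_left.trans hDC))) ?_
    have := hlink.isLinked hC (inf_le_left.trans (le_sup_left.trans hDC))
    intro σ σ' h1 h2 h3 h4
    refine Relation.ReflTransGen.mono ?_ _ _ (this σ σ' h1 h2 h3 h4)
    rintro a b ⟨hb, hbd, τ, h5, h6, h7⟩
    exact ⟨hb, hbd, τ, h5, h6, by omega⟩

/-- A new simplex may be attached along a nonvoid union of its facets. -/
theorem IsBuildable.attach [DecidableEq V] {C : LowerSet (Finset V)} (h : IsBuildable d C)
    {F : Finset V}
    (hF : F.card = d + 1) (h0 : ∅ ∈ C)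
    (hpure : ∀ s ∈ C, s ⊆ F → ∃ σ ∈ C, σ ⊆ F ∧ σ.card = d ∧ s ⊆ σ) :
    IsBuildable d (C ⊔ LowerSet.Iic F) := by
  refine IsBuildable.union C _ h (IsBuildable.simplex F hF) ⟨⟨h0, Finset.empty_subset F⟩, ?_⟩ ?_
  · rintro s ⟨hs, hsF⟩
    obtain ⟨σ, hσ, hσF, hcard, hle⟩ := hpure s hs hsF
    exact ⟨σ, ⟨hσ, hσF⟩, hcard, hle⟩
  · rintro σ σ' ⟨hσ, hσF⟩ hcard ⟨hσ', hσF'⟩ hcard'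
    -- two ridges of a simplex always meet in codimension one
    refine Relation.ReflTransGen.single ⟨⟨hσ', hσF'⟩, hcard', ?_⟩
    have h1 := Finset.card_union_add_card_inter σ σ'
    have h2 := Finset.card_le_card (Finset.union_subset hσF hσF' : σ ∪ σ' ⊆ F)
    omega

/-- Every member with `d` elements lies in at most two members with `d + 1` elements. -/
def IsPseudomanifoldFamily (d : ℕ) (C : LowerSet (Finset V)) : Prop :=
  ∀ σ ∈ C, σ.card = d → ∀ F₁ ∈ C, ∀ F₂ ∈ C, ∀ F₃ ∈ C, F₁.card = d + 1 → F₂.card = d + 1 →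
    F₃.card = d + 1 → σ ⊆ F₁ → σ ⊆ F₂ → σ ⊆ F₃ → F₁ = F₂ ∨ F₁ = F₃ ∨ F₂ = F₃

theorem IsPseudomanifoldFamily.isPseudomanifold [Finite V] {C : LowerSet (Finset V)}
    (h : IsPseudomanifoldFamily d C) (hpure : IsPureFamily (d + 1) C) :
    (ofFinsets C hpure.1).IsPseudomanifold d := by
  refine ⟨?_, fun σ hσ => ?_⟩
  · have := hpure.isPure hpure.1 le_rfl
    rw [restrict_self] at this
    simpa using this
  · by_contra! hcon
    obtain ⟨F₁, F₂, F₃, ⟨hd₁, hle₁⟩, ⟨hd₂, hle₂⟩, ⟨hd₃, hle₃⟩, h12, h13, h23⟩ :=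
      (Set.two_lt_ncard_iff (Set.toFinite _)).1 hcon
    rw [dim_ofFinsets] at hσ hd₁ hd₂ hd₃
    rcases h _ (verts_mem σ) (by omega) _ (verts_mem F₁) _ (verts_mem F₂) _ (verts_mem F₃)
      (by omega) (by omega) (by omega) hle₁ hle₂ hle₃ with h | h | h
    · exact h12 (verts_injective h)
    · exact h13 (verts_injective h)
    · exact h23 (verts_injective h)

/-- The second cohomology modulo 2 does not vanish: some cocycle on the members with three elements
is not a coboundary. -/
def HasCohomologyTwo [DecidableEq V] (C : LowerSet (Finset V)) : Prop :=
  ∃ f : Finset V → ZMod 2, (∀ s ∈ C, s.card = 4 → ∑ v ∈ s, f (s.erase v) = 0) ∧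
    ∀ g : Finset V → ZMod 2, ∃ s ∈ C, s.card = 3 ∧ f s ≠ ∑ v ∈ s, g (s.erase v)

theorem HasCohomologyTwo.not_isAcyclicAt [DecidableEq V] [Finite V]
    {C : LowerSet (Finset V)} (hC : ∅ ∈ C)
    (h : HasCohomologyTwo C) : ¬ (ofFinsets C hC).IsAcyclicAt 2 ⊤ := by
  classical
  obtain ⟨f, hf, hg⟩ := h
  intro hacyc
  obtain ⟨g, hfg⟩ := hacyc (fun F => f (verts F)) (by
    intro F _ hd
    rw [dim_ofFinsets] at hd
    rw [coboundary_ofFinsets]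
    exact hf _ (verts_mem F) (by omega))
  obtain ⟨G, hG⟩ : ∃ G : Finset V → ZMod 2, ∀ F : (ofFinsets C hC).Face, G (verts F) = g F :=
    ⟨fun s => if h : s ∈ C then g (ofVerts hC s h) else 0, fun F => dif_pos (verts_mem F)⟩
  obtain ⟨s, hs, hcard, hne⟩ := hg G
  have h1 := hfg (ofVerts hC s hs) trivial (by rw [dim_ofFinsets, verts_ofVerts, hcard]; rfl)
  rw [coboundary_congr fun F _ => (hG F).symm, coboundary_ofFinsets] at h1
  exact hne h1

/-! ### The boundary of the tetrahedron -/

/-- The proper faces of the tetrahedron. -/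
def tetrahedronBoundary : LowerSet (Finset (Fin 4)) where
  carrier := {s | s ≠ Finset.univ}
  lower' := fun _ _ hba ha h => ha (Finset.univ_subset_iff.1 (h ▸ hba))

theorem isPureFamily_tetrahedronBoundary : IsPureFamily 3 tetrahedronBoundary := by
  have : ∀ s : Finset (Fin 4), s ≠ Finset.univ → ∃ i, i ∉ s := by
    intro s hs
    by_contra! h
    exact hs (Finset.eq_univ_iff_forall.2 h)
  refine ⟨fun h => by simpa using congrArg Finset.card h, fun s hs => ?_⟩
  obtain ⟨i, hi⟩ := this s hs
  refine ⟨Finset.univ.erase i, ?_, by simp, fun j hj => by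
    simp only [Finset.mem_erase, Finset.mem_univ, and_true]; rintro rfl; exact hi hj⟩
  intro h
  have := Finset.mem_univ i
  rw [← h] at this
  exact Finset.notMem_erase i _ this

theorem isBuildable_tetrahedronBoundary : IsBuildable 2 tetrahedronBoundary := by
  have hsimplex : IsBuildable 2 (LowerSet.Iic ({0, 1, 2} : Finset (Fin 4))) :=
    IsBuildable.simplex _ rfl
  have h1 := hsimplex.attach (F := {0, 1, 3}) rfl (Finset.empty_subset _) (by
    simp only [LowerSet.mem_Iic_iff]
    decide)
  have h2 := h1.attach (F := {0, 2, 3}) rfl (Or.inl (Finset.empty_subset _)) (by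
    simp only [LowerSet.mem_sup_iff, LowerSet.mem_Iic_iff]
    decide)
  have h3 := h2.attach (F := {1, 2, 3}) rfl (Or.inl (Or.inl (Finset.empty_subset _))) (by
    simp only [LowerSet.mem_sup_iff, LowerSet.mem_Iic_iff]
    decide)
  convert h3
  ext s
  change s ≠ Finset.univ ↔ _
  simp only [SetLike.mem_coe, LowerSet.mem_sup_iff, LowerSet.mem_Iic_iff]
  revert s
  decide

theorem isPseudomanifoldFamily_tetrahedronBoundary :
    IsPseudomanifoldFamily 2 tetrahedronBoundary := by
  intro σ _ hσ F₁ _ F₂ _ F₃ _ h₁ h₂ h₃ hle₁ hle₂ hle₃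
  by_contra! hcon
  have key : ∀ σ : Finset (Fin 4), σ.card = 2 →
      (Finset.univ.filter fun F : Finset (Fin 4) => F.card = 2 + 1 ∧ σ ⊆ F).card ≤ 2 := by
    decide
  refine (key σ hσ).not_gt (Finset.two_lt_card.2 ⟨F₁, ?_, F₂, ?_, F₃, ?_, hcon⟩) <;>
    simp only [Finset.mem_filter, Finset.mem_univ, *, and_self]

theorem hasCohomologyTwo_tetrahedronBoundary : HasCohomologyTwo tetrahedronBoundary := by
  refine ⟨fun s => if s = Finset.univ.erase 0 then 1 else 0, ?_, ?_⟩
  · intro s hs hcard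
    exact absurd (Finset.eq_univ_of_card s (by simp [hcard])) hs
  · intro g
    by_contra! hcon
    have h : ∀ i : Fin 4, (if (Finset.univ.erase i : Finset (Fin 4)) = Finset.univ.erase 0 then
        (1 : ZMod 2) else 0) =
        ∑ v ∈ Finset.univ.erase i, g ((Finset.univ.erase i).erase v) := by
      intro i
      refine hcon _ (fun h => ?_) (by simp)
      have := Finset.mem_univ i
      rw [← h] at this
      exact Finset.notMem_erase i _ this
    have h1 := sum_sum_erase_erase (Finset.univ : Finset (Fin 4)) g
    rw [← Finset.sum_congr rfl fun i _ => h i] at h1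
    revert h1
    decide

end Families

/-! ### Prisms -/

section Prism

variable {V : Type} {r : V → ℕ} {C : LowerSet (Finset V)}

/-- The vertices of `F` up to `y` at the bottom together with the vertices from `x` on at the
top. -/
def stair (r : V → ℕ) (F : Finset V) (y x : V) : Finset (V ⊕ V) :=
  (F.filter (r · ≤ r y)).disjSum (F.filter (r x ≤ r ·))

theorem mem_stair_inl {F : Finset V} {x y v : V} :
    Sum.inl v ∈ stair r F y x ↔ v ∈ F ∧ r v ≤ r y := by simp [stair]

theorem mem_stair_inr {F : Finset V} {x y v : V} :
    Sum.inr v ∈ stair r F y x ↔ v ∈ F ∧ r x ≤ r v := by simp [stair]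

theorem subset_stair {F : Finset V} {x y : V} {s : Finset (V ⊕ V)} :
    s ⊆ stair r F y x ↔ (∀ v ∈ s.toLeft, v ∈ F ∧ r v ≤ r y) ∧
      (∀ v ∈ s.toRight, v ∈ F ∧ r x ≤ r v) := by
  rw [stair, Finset.subset_disjSum]
  simp only [Finset.subset_iff, Finset.mem_filter]

/-- Between consecutive vertices, the stair has one element for each vertex. -/
theorem card_stair_of_lt {F : Finset V} {x y : V} (hyx : r y < r x)
    (hbetween : ∀ v ∈ F, r v ≤ r y ∨ r x ≤ r v) : (stair r F y x).card = F.card := by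
  rw [stair, Finset.card_disjSum, ← Finset.card_filter_add_card_filter_not (s := F) (r · ≤ r y)]
  congr 2
  refine Finset.filter_congr fun v hv => ?_
  have := hbetween v hv
  omega

variable [DecidableEq V]

/-- The projection of a set of vertices of the prism to the base. -/
def base (s : Finset (V ⊕ V)) : Finset V := s.toLeft ∪ s.toRight

theorem base_mono {s u : Finset (V ⊕ V)} (h : s ⊆ u) : base s ⊆ base u :=
  Finset.union_subset_union (Finset.toLeft_subset_toLeft h) (Finset.toRight_subset_toRight h)

/-- The prism over `C`, triangulated with respect to an ordering `r` of the vertices: its members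
lie over members of `C`, their bottom vertices preceding their top vertices. -/
def prism (r : V → ℕ) (C : LowerSet (Finset V)) : LowerSet (Finset (V ⊕ V)) where
  carrier := {s | base s ∈ C ∧ ∀ v ∈ s.toLeft, ∀ w ∈ s.toRight, r v ≤ r w}
  lower' := fun _ _ hba ha => ⟨C.lower (base_mono hba) ha.1, fun v hv w hw =>
    ha.2 v (Finset.toLeft_subset_toLeft hba hv) w (Finset.toRight_subset_toRight hba hw)⟩

theorem base_subset_of_subset_stair {F : Finset V} {x y : V} {s : Finset (V ⊕ V)}
    (h : s ⊆ stair r F y x) : base s ⊆ F := by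
  rw [subset_stair] at h
  exact Finset.union_subset (fun v hv => (h.1 v hv).1) (fun v hv => (h.2 v hv).1)

theorem stair_mem_prism {F : Finset V} (hF : F ∈ C) {x y : V} (h : r y ≤ r x) :
    stair r F y x ∈ prism r C := by
  refine ⟨C.lower (base_subset_of_subset_stair subset_rfl) hF, fun v hv w hw => ?_⟩
  rw [Finset.mem_toLeft, mem_stair_inl] at hv
  rw [Finset.mem_toRight, mem_stair_inr] at hw
  omega

theorem card_stair_self (hr : Function.Injective r) {F : Finset V} {x : V} (hx : x ∈ F) :
    (stair r F x x).card = F.card + 1 := by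
  rw [stair, Finset.card_disjSum, ← Finset.card_union_add_card_inter]
  have h1 : F.filter (r · ≤ r x) ∪ F.filter (r x ≤ r ·) = F := by
    ext v
    simp only [Finset.mem_union, Finset.mem_filter]
    have := le_total (r v) (r x)
    tauto
  have h2 : F.filter (r · ≤ r x) ∩ F.filter (r x ≤ r ·) = {x} := by
    ext v
    simp only [Finset.mem_inter, Finset.mem_filter, Finset.mem_singleton]
    constructor
    · rintro ⟨⟨-, h⟩, -, h'⟩
      exact hr (le_antisymm h h')
    · rintro rfl
      exact ⟨⟨hx, le_rfl⟩, hx, le_rfl⟩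
  rw [h1, h2, Finset.card_singleton]

theorem exists_subset_stair {s : Finset (V ⊕ V)} (hs : s ∈ prism r C) {F : Finset V}
    (hsF : base s ⊆ F) (hF : F.Nonempty) : ∃ x ∈ F, s ⊆ stair r F x x := by
  have hl : ∀ v ∈ s.toLeft, v ∈ F := fun v hv => hsF (Finset.mem_union_left _ hv)
  have hr' : ∀ v ∈ s.toRight, v ∈ F := fun v hv => hsF (Finset.mem_union_right _ hv)
  rcases s.toLeft.eq_empty_or_nonempty with h | h
  · rcases s.toRight.eq_empty_or_nonempty with h' | h'
    · obtain ⟨x, hx⟩ := hF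
      exact ⟨x, hx, subset_stair.2 ⟨by simp [h], by simp [h']⟩⟩
    · obtain ⟨x, hx, hmin⟩ := Finset.exists_min_image _ r h'
      exact ⟨x, hr' x hx, subset_stair.2 ⟨by simp [h], fun v hv => ⟨hr' v hv, hmin v hv⟩⟩⟩
  · obtain ⟨x, hx, hmax⟩ := Finset.exists_max_image _ r h
    exact ⟨x, hl x hx, subset_stair.2 ⟨fun v hv => ⟨hl v hv, hmax v hv⟩,
      fun v hv => ⟨hr' v hv, hs.2 x hx v hv⟩⟩⟩

theorem card_base_add_card_inter (s : Finset (V ⊕ V)) :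
    (base s).card + (s.toLeft ∩ s.toRight).card = s.card := by
  rw [base, Finset.card_union_add_card_inter, Finset.card_toLeft_add_card_toRight]

theorem card_inter_le_one (hr : Function.Injective r) {s : Finset (V ⊕ V)} (hs : s ∈ prism r C) :
    (s.toLeft ∩ s.toRight).card ≤ 1 := by
  refine Finset.card_le_one.2 fun a ha b hb => ?_
  rw [Finset.mem_inter] at ha hb
  exact hr (le_antisymm (hs.2 a ha.1 b hb.2) (hs.2 b hb.1 a ha.2))

theorem prism_sup (C₁ C₂ : LowerSet (Finset V)) :
    prism r (C₁ ⊔ C₂) = prism r C₁ ⊔ prism r C₂ :=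
  LowerSet.ext (Set.ext fun _ => or_and_right)

theorem prism_inf (C₁ C₂ : LowerSet (Finset V)) :
    prism r (C₁ ⊓ C₂) = prism r C₁ ⊓ prism r C₂ :=
  LowerSet.ext (Set.ext fun _ => and_and_right)

theorem IsPureFamily.prism (hr : Function.Injective r) {n : ℕ} (hn : 1 ≤ n)
    (hC : IsPureFamily n C) : IsPureFamily (n + 1) (prism r C) := by
  refine ⟨⟨hC.1, by simp⟩, fun s hs => ?_⟩
  obtain ⟨F, hF, hcard, hle⟩ := hC.2 _ hs.1
  obtain ⟨x, hx, hsx⟩ := exists_subset_stair hs hle (Finset.card_pos.1 (by omega))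
  exact ⟨_, stair_mem_prism hF le_rfl, by rw [card_stair_self hr hx, hcard], hsx⟩

theorem exists_eq_stair (hr : Function.Injective r) {n : ℕ} (hn : 1 ≤ n)
    (hC : IsPureFamily n C) {s : Finset (V ⊕ V)} (hs : s ∈ prism r C) (hcard : s.card = n + 1) :
    ∃ F ∈ C, F.card = n ∧ ∃ x ∈ F, s = stair r F x x := by
  obtain ⟨F, hF, hFc, hle⟩ := hC.2 _ hs.1
  obtain ⟨x, hx, hsx⟩ := exists_subset_stair hs hle (Finset.card_pos.1 (by omega))
  exact ⟨F, hF, hFc, x, hx, Finset.eq_of_subset_of_card_le hsx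
    (by rw [card_stair_self hr hx, hFc, hcard])⟩

theorem IsPseudomanifoldFamily.prism (hr : Function.Injective r)
    (hpure : IsPureFamily (d + 1) C) (hC : IsPseudomanifoldFamily d C) :
    IsPseudomanifoldFamily (d + 1) (prism r C) := by
  intro σ hσ hσd Φ₁ hΦ₁ Φ₂ hΦ₂ Φ₃ hΦ₃ h₁ h₂ h₃ hle₁ hle₂ hle₃
  obtain ⟨F₁, hF₁, hc₁, x₁, hx₁, rfl⟩ := exists_eq_stair hr (by omega) hpure hΦ₁ h₁
  obtain ⟨F₂, hF₂, hc₂, x₂, hx₂, rfl⟩ := exists_eq_stair hr (by omega) hpure hΦ₂ h₂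
  obtain ⟨F₃, hF₃, hc₃, x₃, hx₃, rfl⟩ := exists_eq_stair hr (by omega) hpure hΦ₃ h₃
  have b₁ := base_subset_of_subset_stair hle₁
  have b₂ := base_subset_of_subset_stair hle₂
  have b₃ := base_subset_of_subset_stair hle₃
  rw [subset_stair] at hle₁ hle₂ hle₃
  have hcard := card_base_add_card_inter σ
  have hinter := card_inter_le_one hr hσ
  rcases Nat.eq_zero_or_pos (σ.toLeft ∩ σ.toRight).card with h0 | hpos
  · -- the ridge lies over a facet; it is `σ = stair F x x` without one of the two copies of `x`
    have e₁ : base σ = F₁ := Finset.eq_of_subset_of_card_le b₁ (by omega)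
    have e₂ : base σ = F₂ := Finset.eq_of_subset_of_card_le b₂ (by omega)
    have e₃ : base σ = F₃ := Finset.eq_of_subset_of_card_le b₃ (by omega)
    subst e₁ e₂
    rw [← e₃] at hx₃ ⊢
    simp only [base, Finset.mem_union] at hx₁ hx₂ hx₃
    have left : ∀ {x y : V}, (∀ v ∈ σ.toLeft, v ∈ base σ ∧ r v ≤ r x) →
        (∀ v ∈ σ.toLeft, v ∈ base σ ∧ r v ≤ r y) → x ∈ σ.toLeft → y ∈ σ.toLeft → x = y :=
      fun h h' hx hy => hr (le_antisymm (h' _ hx).2 (h _ hy).2)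
    have right : ∀ {x y : V}, (∀ v ∈ σ.toRight, v ∈ base σ ∧ r x ≤ r v) →
        (∀ v ∈ σ.toRight, v ∈ base σ ∧ r y ≤ r v) → x ∈ σ.toRight → y ∈ σ.toRight → x = y :=
      fun h h' hx hy => hr (le_antisymm (h _ hy).2 (h' _ hx).2)
    rw [← e₃] at hle₃
    rcases hx₁ with hx₁ | hx₁ <;> rcases hx₂ with hx₂ | hx₂ <;> rcases hx₃ with hx₃ | hx₃
    · exact Or.inl (by rw [left hle₁.1 hle₂.1 hx₁ hx₂])
    · exact Or.inl (by rw [left hle₁.1 hle₂.1 hx₁ hx₂])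
    · exact Or.inr (Or.inl (by rw [left hle₁.1 hle₃.1 hx₁ hx₃]))
    · exact Or.inr (Or.inr (by rw [right hle₂.2 hle₃.2 hx₂ hx₃]))
    · exact Or.inr (Or.inr (by rw [left hle₂.1 hle₃.1 hx₂ hx₃]))
    · exact Or.inr (Or.inl (by rw [right hle₁.2 hle₃.2 hx₁ hx₃]))
    · exact Or.inl (by rw [right hle₁.2 hle₂.2 hx₁ hx₂])
    · exact Or.inl (by rw [right hle₁.2 hle₂.2 hx₁ hx₂])
  · -- the ridge lies over a ridge, and both copies of the doubled vertex are present
    obtain ⟨z, hz⟩ := Finset.card_pos.1 hpos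
    rw [Finset.mem_inter] at hz
    have z₁ : x₁ = z := hr (le_antisymm (hle₁.2 z hz.2).2 (hle₁.1 z hz.1).2)
    have z₂ : x₂ = z := hr (le_antisymm (hle₂.2 z hz.2).2 (hle₂.1 z hz.1).2)
    have z₃ : x₃ = z := hr (le_antisymm (hle₃.2 z hz.2).2 (hle₃.1 z hz.1).2)
    subst z₁ z₂ z₃
    rcases hC (base σ) hσ.1 (by omega) F₁ hF₁ F₂ hF₂ F₃ hF₃ hc₁ hc₂ hc₃ b₁ b₂ b₃ with
      rfl | rfl | rfl
    · exact Or.inl rfl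
    · exact Or.inr (Or.inl rfl)
    · exact Or.inr (Or.inr rfl)

/-- In the prism over a simplex, any two maximal simplices are joined by exchanging one vertex at a
time. -/
theorem reflTransGen_stair (hr : Function.Injective r) {F : Finset V} (hF : F ∈ C) {n : ℕ}
    (hn : F.card = n) {x y : V} (hx : x ∈ F) (hy : y ∈ F) :
    Relation.ReflTransGen
      (fun a b => b ∈ prism r C ∧ b.card = n + 1 ∧ n + 1 ≤ (a ∩ b).card + 1)
      (stair r F x x) (stair r F y y) := by
  induction hk : Nat.dist (r x) (r y) using Nat.strong_induction_on generalizing x y with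
  | _ k ih =>
  by_cases heq : r x = r y
  · rw [hr heq]
  by_cases hz : ∃ z ∈ F, (r x < r z ∧ r z < r y) ∨ (r y < r z ∧ r z < r x)
  · obtain ⟨z, hzF, hz⟩ := hz
    unfold Nat.dist at hk ih
    exact (ih _ (by omega) hx hzF rfl).trans (ih _ (by omega) hzF hy rfl)
  push Not at hz
  have key : ∀ x y, r y < r x → (∀ v ∈ F, r v ≤ r y ∨ r x ≤ r v) →
      n ≤ (stair r F x x ∩ stair r F y y).card := by
    intro x y hyx hb
    rw [← hn, ← card_stair_of_lt hyx hb]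
    refine Finset.card_le_card ?_
    rintro (v | v) hv
    · rw [mem_stair_inl] at hv
      rw [Finset.mem_inter, mem_stair_inl, mem_stair_inl]
      exact ⟨⟨hv.1, by omega⟩, hv⟩
    · rw [mem_stair_inr] at hv
      rw [Finset.mem_inter, mem_stair_inr, mem_stair_inr]
      exact ⟨hv, hv.1, by omega⟩
  refine Relation.ReflTransGen.single
    ⟨stair_mem_prism hF le_rfl, by rw [card_stair_self hr hy, hn], Nat.succ_le_succ ?_⟩
  rcases lt_or_gt_of_ne heq with h | h
  · rw [Finset.inter_comm]
    refine key y x h fun v hv => ?_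
    have := (hz v hv).1
    omega
  · refine key x y h fun v hv => ?_
    have := (hz v hv).2
    omega

theorem IsLinkedFamily.prism (hr : Function.Injective r) {n : ℕ} (hn : 2 ≤ n)
    (hpure : IsPureFamily n C) (hC : IsLinkedFamily n C) :
    IsLinkedFamily (n + 1) (prism r C) := by
  intro s s' hs hsn hs' hsn'
  obtain ⟨σ, hσ, hσc, x, hx, rfl⟩ := exists_eq_stair hr (by omega) hpure hs hsn
  obtain ⟨σ', hσ', hσc', x', hx', rfl⟩ := exists_eq_stair hr (by omega) hpure hs' hsn'
  have key := hC σ σ' hσ hσc hσ' hσc'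
  clear hs' hsn' hσ' hσc'
  induction key generalizing x' with
  | refl => exact reflTransGen_stair hr hσ hσc hx hx'
  | @tail a b _ hab ih =>
    obtain ⟨hb, hbc, hcard⟩ := hab
    obtain ⟨y, hy⟩ : (a ∩ b).Nonempty := Finset.card_pos.1 (by omega)
    have hy' := Finset.mem_inter.1 hy
    refine ((ih y hy'.1).tail ⟨stair_mem_prism hb le_rfl,
      by rw [card_stair_self hr hy'.2, hbc], ?_⟩).trans (reflTransGen_stair hr hb hbc hy'.2 hx')
    have h1 : stair r (a ∩ b) y y ⊆ stair r a y y ∩ stair r b y y := by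
      rintro (v | v) hv
      · rw [mem_stair_inl, Finset.mem_inter] at hv
        rw [Finset.mem_inter, mem_stair_inl, mem_stair_inl]
        exact ⟨⟨hv.1.1, hv.2⟩, hv.1.2, hv.2⟩
      · rw [mem_stair_inr, Finset.mem_inter] at hv
        rw [Finset.mem_inter, mem_stair_inr, mem_stair_inr]
        exact ⟨⟨hv.1.1, hv.2⟩, hv.1.2, hv.2⟩
    have h2 := Finset.card_le_card h1
    rw [card_stair_self hr hy] at h2
    omega

/-- The first maximal simplices of the prism over a simplex. -/
def partialPrism (r : V → ℕ) (F : Finset V) (n : ℕ) : LowerSet (Finset (V ⊕ V)) where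
  carrier := {s | ∃ x ∈ F, r x < n ∧ s ⊆ stair r F x x}
  lower' := fun _ _ hba ⟨x, hx, hn, h⟩ => ⟨x, hx, hn, hba.trans h⟩

theorem isBuildable_partialPrism (hr : Function.Injective r) {F : Finset V} (hF : F.card = d + 1)
    (n : ℕ) (hn : ∃ x ∈ F, r x < n) : IsBuildable (d + 1) (partialPrism r F n) := by
  induction n with
  | zero => obtain ⟨x, -, h⟩ := hn; omega
  | succ n ih =>
    by_cases hx : ∃ x ∈ F, r x = n
    · obtain ⟨x, hxF, hxn⟩ := hx
      have hcard : (stair r F x x).card = d + 1 + 1 := by rw [card_stair_self hr hxF, hF]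
      by_cases hy : ∃ y ∈ F, r y < n
      · have h1 : partialPrism r F (n + 1) = partialPrism r F n ⊔ LowerSet.Iic (stair r F x x) := by
          ext s
          constructor
          · rintro ⟨z, hz, hzn, hs⟩
            rcases Nat.lt_succ_iff_lt_or_eq.1 hzn with h | h
            · exact Or.inl ⟨z, hz, h, hs⟩
            · rw [hr (h.trans hxn.symm)] at hs
              exact Or.inr hs
          · rintro (⟨z, hz, hzn, hs⟩ | hs)
            · exact ⟨z, hz, by omega, hs⟩
            · exact ⟨x, hxF, by omega, hs⟩
        rw [h1]
        -- the new simplex meets the old ones in a single ridge, shared with its predecessor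
        obtain ⟨y, hy, hmax⟩ := Finset.exists_max_image (F.filter (r · < n)) r
          (by obtain ⟨y, hy⟩ := hy; exact ⟨y, Finset.mem_filter.2 hy⟩)
        rw [Finset.mem_filter] at hy
        refine (ih ⟨y, hy⟩).attach hcard ⟨y, hy.1, hy.2, Finset.empty_subset _⟩ ?_
        rintro s ⟨z, hz, hzn, hs⟩ hsx
        refine ⟨stair r F y x, ⟨y, hy.1, hy.2, ?_⟩, ?_, ?_, ?_⟩
        · rw [subset_stair]
          simp only [Finset.mem_toLeft, Finset.mem_toRight, mem_stair_inl, mem_stair_inr]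
          exact ⟨fun _ h => h, fun v h => ⟨h.1, by omega⟩⟩
        · rw [subset_stair]
          simp only [Finset.mem_toLeft, Finset.mem_toRight, mem_stair_inl, mem_stair_inr]
          exact ⟨fun v h => ⟨h.1, by omega⟩, fun _ h => h⟩
        · rw [card_stair_of_lt (by omega), hF]
          intro v hv
          have := hmax v
          rw [Finset.mem_filter] at this
          by_cases h : r v < n
          · exact Or.inl (this ⟨hv, h⟩)
          · exact Or.inr (by omega)
        · rw [subset_stair] at hs hsx ⊢
          have := hmax z (Finset.mem_filter.2 ⟨hz, hzn⟩)
          exact ⟨fun v hv => ⟨(hs.1 v hv).1, (hs.1 v hv).2.trans this⟩, hsx.2⟩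
      · have h1 : partialPrism r F (n + 1) = LowerSet.Iic (stair r F x x) := by
          ext s
          constructor
          · rintro ⟨z, hz, hzn, hs⟩
            have : r z = r x := by
              by_contra h
              exact hy ⟨z, hz, by omega⟩
            rw [hr this] at hs
            exact hs
          · exact fun hs => ⟨x, hxF, by omega, hs⟩
        rw [h1]
        exact IsBuildable.simplex _ hcard
    · have hlt : ∀ x ∈ F, r x < n + 1 ↔ r x < n := fun x hxF =>
        ⟨fun h => (Nat.lt_succ_iff_lt_or_eq.1 h).resolve_right fun h => hx ⟨x, hxF, h⟩,
          fun h => by omega⟩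
      have h1 : partialPrism r F (n + 1) = partialPrism r F n := by
        ext s
        exact ⟨fun ⟨x, h, h', h''⟩ => ⟨x, h, (hlt x h).1 h', h''⟩,
          fun ⟨x, h, h', h''⟩ => ⟨x, h, (hlt x h).2 h', h''⟩⟩
      rw [h1]
      obtain ⟨x, hxF, hxn⟩ := hn
      exact ih ⟨x, hxF, (hlt x hxF).1 hxn⟩

theorem IsBuildable.prism (hr : Function.Injective r) (hd : 2 ≤ d) (h : IsBuildable d C) :
    IsBuildable (d + 1) (prism r C) := by
  induction h with
  | simplex F hF =>
    have hne : F.Nonempty := Finset.card_pos.1 (by omega)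
    have h1 : SimplicialCW.prism r (LowerSet.Iic F) = partialPrism r F (F.sup r + 1) := by
      ext s
      constructor
      · intro hs
        obtain ⟨x, hx, hsx⟩ := exists_subset_stair hs hs.1 hne
        exact ⟨x, hx, Nat.lt_succ_of_le (Finset.le_sup hx), hsx⟩
      · rintro ⟨x, hx, -, hs⟩
        exact (SimplicialCW.prism r _).lower hs
          (stair_mem_prism (LowerSet.mem_Iic_iff.2 le_rfl) le_rfl)
    rw [h1]
    obtain ⟨x, hx⟩ := hne
    exact isBuildable_partialPrism hr hF _ ⟨x, hx, Nat.lt_succ_of_le (Finset.le_sup hx)⟩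
  | union C₁ C₂ _ _ hpure hlink ih₁ ih₂ =>
    rw [prism_sup]
    refine IsBuildable.union _ _ ih₁ ih₂ ?_ ?_ <;> rw [← prism_inf]
    · exact hpure.prism hr (by omega)
    · exact hlink.prism hr hd hpure

/-- A nontrivial cohomology class of the base pulls back to a nontrivial class of the prism, as its
restriction to the bottom shows. -/
theorem HasCohomologyTwo.prism (hr : Function.Injective r) (h : HasCohomologyTwo C) :
    HasCohomologyTwo (prism r C) := by
  obtain ⟨f, hf, hg⟩ := h
  refine ⟨fun s => if s.toLeft ∩ s.toRight = ∅ then f (base s) else 0, ?_, ?_⟩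
  · intro s hs hcard
    have hsum : ∀ φ : V ⊕ V → ZMod 2,
        ∑ v ∈ s, φ v = ∑ v ∈ s.toLeft, φ (Sum.inl v) + ∑ v ∈ s.toRight, φ (Sum.inr v) := by
      intro φ
      conv_lhs => rw [← Finset.toLeft_disjSum_toRight (u := s)]
      rw [Finset.sum_disjSum]
    have hl : ∀ v, (s.erase (Sum.inl v)).toLeft = s.toLeft.erase v := by
      intro v; ext w; simp
    have hl' : ∀ v, (s.erase (Sum.inr v)).toLeft = s.toLeft := by
      intro v; ext w; simp
    have hr₁ : ∀ v, (s.erase (Sum.inr v)).toRight = s.toRight.erase v := by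
      intro v; ext w; simp
    have hr₂ : ∀ v, (s.erase (Sum.inl v)).toRight = s.toRight := by
      intro v; ext w; simp
    rw [hsum]
    simp only [base, hl, hl', hr₁, hr₂]
    have hci := card_base_add_card_inter s
    rcases Finset.eq_empty_or_nonempty (s.toLeft ∩ s.toRight) with h0 | ⟨z, hz⟩
    · have hdisj : Disjoint s.toLeft s.toRight := Finset.disjoint_iff_inter_eq_empty.2 h0
      rw [h0, Finset.card_empty, add_zero] at hci
      rw [← hf (base s) hs.1 (hci.trans hcard), base, Finset.sum_union hdisj]
      congr 1
      · refine Finset.sum_congr rfl fun v hv => ?_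
        have hv' : v ∉ s.toRight := Finset.disjoint_left.1 hdisj hv
        rw [Finset.erase_inter, h0, Finset.erase_empty, if_pos rfl, Finset.erase_union_distrib,
          Finset.erase_eq_of_notMem hv']
      · refine Finset.sum_congr rfl fun v hv => ?_
        have hv' : v ∉ s.toLeft := Finset.disjoint_right.1 hdisj hv
        rw [Finset.inter_erase, h0, Finset.erase_empty, if_pos rfl, Finset.erase_union_distrib,
          Finset.erase_eq_of_notMem hv']
    · have hz' := Finset.mem_inter.1 hz
      have h1 : s.toLeft ∩ s.toRight = {z} := by
        refine Finset.eq_singleton_iff_unique_mem.2 ⟨hz, fun w hw => ?_⟩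
        exact Finset.card_le_one.1 (card_inter_le_one hr hs) w hw z hz
      have hne : ∀ v, ({z} : Finset V).erase v = ∅ ↔ v = z := by
        intro v
        rw [Finset.erase_eq_empty_iff]
        simp [eq_comm]
      simp only [Finset.erase_inter, Finset.inter_erase, h1, hne]
      rw [Finset.sum_ite_eq_of_mem' _ _ _ hz'.1, Finset.sum_ite_eq_of_mem' _ _ _ hz'.2]
      have e₁ : s.toLeft.erase z ∪ s.toRight = base s := by
        ext v
        by_cases hv : v = z
        · subst hv; simp [base, hz'.2]
        · simp [base, hv]
      have e₂ : s.toLeft ∪ s.toRight.erase z = base s := by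
        ext v
        by_cases hv : v = z
        · subst hv; simp [base, Finset.mem_toLeft.1 hz'.1]
        · simp [base, hv]
      rw [e₁, e₂]
      exact CharTwo.add_self_eq_zero _
  · intro g
    obtain ⟨s, hs, hcard, hne⟩ := hg fun s => g (s.disjSum ∅)
    have hbase : ∀ u : Finset V, base (u.disjSum ∅) = u := by
      intro u
      rw [base, Finset.toLeft_disjSum, Finset.toRight_disjSum, Finset.union_empty]
    refine ⟨s.disjSum ∅, ⟨by rw [hbase]; exact hs, by simp⟩, by simp [hcard], ?_⟩
    beta_reduce
    rw [hbase, Finset.toLeft_disjSum, Finset.toRight_disjSum, Finset.inter_empty, if_pos rfl,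
      Finset.sum_disjSum, Finset.sum_empty, add_zero]
    have : ∀ v ∈ s, g ((s.disjSum ∅).erase (Sum.inl v)) = g ((s.erase v).disjSum ∅) := by
      intro v _
      congr 1
      ext w
      rcases w with w | w <;> simp
    rw [Finset.sum_congr rfl this]
    exact hne

end Prism

/-! ### Pseudomanifolds of every dimension with second cohomology -/

/-- Iterated prisms over the boundary of the tetrahedron. -/
theorem exists_family (d : ℕ) (hd : 2 ≤ d) :
    ∃ (V : Type) (_ : Finite V) (_ : DecidableEq V) (C : LowerSet (Finset V)),
      IsPureFamily (d + 1) C ∧ IsPseudomanifoldFamily d C ∧ IsBuildable d C ∧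
        HasCohomologyTwo C := by
  induction d, hd using Nat.le_induction with
  | base =>
    exact ⟨Fin 4, inferInstance, inferInstance, tetrahedronBoundary,
      isPureFamily_tetrahedronBoundary, isPseudomanifoldFamily_tetrahedronBoundary,
      isBuildable_tetrahedronBoundary, hasCohomologyTwo_tetrahedronBoundary⟩
  | succ d hd ih =>
    obtain ⟨V, _, _, C, h1, h2, h3, h4⟩ := ih
    obtain ⟨n, ⟨e⟩⟩ := Finite.exists_equiv_fin V
    have hr : Function.Injective fun v => (e v : ℕ) := Fin.val_injective.comp e.injective
    exact ⟨V ⊕ V, inferInstance, inferInstance, prism (fun v => e v) C,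
      h1.prism hr (by omega), h2.prism hr h1, h3.prism hr hd, h4.prism hr⟩

/-! ### Complexes with a local construction are connected -/

/-- No set of nonempty faces other than the extreme ones is a union of components. -/
def IsConnectedPoset (K : SimplicialCW) (C : LowerSet K.Face) : Prop :=
  ∀ S : Set K.Face, (∀ x y, x ≠ ⊥ → x ≤ y → (x ∈ S ↔ y ∈ S)) →
    ∀ x ∈ C, ∀ y ∈ C, x ≠ ⊥ → y ≠ ⊥ → x ∈ S → y ∈ S

theorem IsTreeSub.isConnectedPoset {K : SimplicialCW} (hd : 1 ≤ d) {C : LowerSet K.Face}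
    (h : K.IsTreeSub d C) : K.IsConnectedPoset C := by
  intro S hS
  induction h with
  | simplex F hF =>
    intro x hx y hy hx0 hy0 hxS
    exact (hS y F hy0 hy).2 ((hS x F hx0 hx).1 hxS)
  | attach C σ F hC hσ hF hint ih =>
    have hσ0 : σ ≠ ⊥ := by
      rintro rfl
      have := hσ.1
      rw [dim_bot] at this
      omega
    have hσmem : σ ∈ C ⊓ LowerSet.Iic F := by
      rw [hint]
      exact LowerSet.mem_Iic_iff.2 le_rfl
    have hσF := hS σ F hσ0 hσmem.2
    rintro x (hx | hx) y (hy | hy) hx0 hy0 hxS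
    · exact ih x hx y hy hx0 hy0 hxS
    · exact (hS y F hy0 hy).2 (hσF.1 (ih x hx σ hσmem.1 hx0 hσ0 hxS))
    · exact ih σ hσmem.1 y hy hσ0 hy0 (hσF.2 ((hS x F hx0 hx).1 hxS))
    · exact (hS y F hy0 hy).2 ((hS x F hx0 hx).1 hxS)

theorem IsTLCGluing.isConnectedPoset {P Q : SimplicialCW} (h : IsTLCGluing d t P Q)
    (hP : P.IsConnectedPoset ⊤) : Q.IsConnectedPoset ⊤ := by
  obtain ⟨Δ, Δ', -, -, -, -, φ, π, hsurj, heq, hle⟩ := h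
  have hbot : π ⊥ = ⊥ := by
    obtain ⟨z, hz⟩ := hsurj ⊥
    exact le_bot_iff.1 (hz ▸ (hle ⊥ z).2 ⟨⊥, z, rfl, rfl, bot_le⟩)
  intro S hS x _ y _ hx0 hy0 hxS
  obtain ⟨x, rfl⟩ := hsurj x
  obtain ⟨y, rfl⟩ := hsurj y
  have hne : ∀ z, π z ≠ ⊥ → z ≠ ⊥ := fun z hz h => hz (h ▸ hbot)
  have hcls : ∀ a b, Relation.EqvGen (fun a b => ∃ h : a ≤ Δ, (φ ⟨a, h⟩ : P.Face) = b) a b →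
      (a = ⊥ ↔ b = ⊥) := by
    intro a b hab
    induction hab with
    | rel a b h =>
      obtain ⟨h, rfl⟩ := h
      have h1 : φ ⟨⊥, bot_le⟩ = ⟨⊥, bot_le⟩ :=
        le_antisymm (φ.le_symm_apply.1 (show (⊥ : P.Face) ≤ _ from bot_le))
          (show (⊥ : P.Face) ≤ _ from bot_le)
      constructor
      · rintro rfl
        rw [h1]
      · intro h2
        have h3 : φ ⟨a, h⟩ = φ ⟨⊥, bot_le⟩ := by
          rw [h1]
          exact Subtype.ext h2
        exact congrArg Subtype.val (φ.injective h3)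
    | refl => exact Iff.rfl
    | symm _ _ _ ih => exact ih.symm
    | trans _ _ _ _ _ ih ih' => exact ih.trans ih'
  have hne' : ∀ z, z ≠ ⊥ → π z ≠ ⊥ := fun z hz h =>
    hz ((hcls z ⊥ ((heq z ⊥).1 (h.trans hbot.symm))).2 rfl)
  exact hP (π ⁻¹' S)
    (fun a b ha hab => hS (π a) (π b) (hne' a ha) ((hle a b).2 ⟨a, b, rfl, rfl, hab⟩))
    x trivial y trivial (hne x hx0) (hne y hy0) hxS

theorem not_hasTLocalConstruction_of_not_isConnectedPoset {K : SimplicialCW} (hd : 1 ≤ d)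
    (hK : ¬ K.IsConnectedPoset ⊤) : ¬ K.HasTLocalConstruction d t := by
  rintro ⟨T, hT, h⟩
  apply hK
  clear hK
  induction h with
  | refl => exact IsTreeSub.isConnectedPoset hd hT
  | tail _ h ih => exact h.isConnectedPoset ih

/-! ### Two disjoint simplices -/

/-- The faces of the disjoint union of two `d`-simplices. -/
def twoSimplices (d : ℕ) : LowerSet (Finset (Bool × Fin (d + 1))) where
  carrier := {s | ∃ b, ∀ v ∈ s, v.1 = b}
  lower' := fun _ _ hba ⟨b, h⟩ => ⟨b, fun v hv => h v (hba hv)⟩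

theorem card_filter_fst (d : ℕ) (b : Bool) :
    (Finset.univ.filter fun v : Bool × Fin (d + 1) => v.1 = b).card = d + 1 := by
  have : (Finset.univ.filter fun v : Bool × Fin (d + 1) => v.1 = b) =
      {b} ×ˢ Finset.univ := by
    ext ⟨c, i⟩
    simp [eq_comm]
  rw [this, Finset.card_product]
  simp

theorem isPureFamily_twoSimplices (d : ℕ) : IsPureFamily (d + 1) (twoSimplices d) := by
  refine ⟨⟨true, by simp⟩, ?_⟩
  rintro s ⟨b, hb⟩
  exact ⟨_, ⟨b, fun v hv => (Finset.mem_filter.1 hv).2⟩, card_filter_fst d b,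
    fun v hv => Finset.mem_filter.2 ⟨Finset.mem_univ v, hb v hv⟩⟩

theorem isPseudomanifoldFamily_twoSimplices (hd : 1 ≤ d) :
    IsPseudomanifoldFamily d (twoSimplices d) := by
  intro σ _ hσ F₁ hF₁ F₂ hF₂ F₃ _ h₁ h₂ _ hle₁ hle₂ _
  obtain ⟨v, hv⟩ := Finset.card_pos.1 (by omega : 0 < σ.card)
  have key : ∀ F ∈ twoSimplices d, F.card = d + 1 → σ ⊆ F →
      F = Finset.univ.filter fun w : Bool × Fin (d + 1) => w.1 = v.1 := by
    rintro F ⟨b, hb⟩ hF hle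
    refine Finset.eq_of_subset_of_card_le (fun w hw => ?_) (by rw [card_filter_fst, hF])
    exact Finset.mem_filter.2 ⟨Finset.mem_univ w, (hb w hw).trans (hb v (hle hv)).symm⟩
  exact Or.inl ((key F₁ hF₁ h₁ hle₁).trans (key F₂ hF₂ h₂ hle₂).symm)

theorem not_isConnectedPoset_twoSimplices (d : ℕ) :
    ¬ (ofFinsets (twoSimplices d) (isPureFamily_twoSimplices d).1).IsConnectedPoset ⊤ := by
  intro h
  have hmem : ∀ b, ({(b, 0)} : Finset (Bool × Fin (d + 1))) ∈ twoSimplices d := fun b =>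
    ⟨b, fun v hv => by rw [Finset.mem_singleton.1 hv]⟩
  have hne : ∀ F : (ofFinsets (twoSimplices d) (isPureFamily_twoSimplices d).1).Face,
      F ≠ ⊥ ↔ (verts F).Nonempty := by
    intro F
    rw [Finset.nonempty_iff_ne_empty]
    exact not_congr (verts_injective.eq_iff (b := ⊥)).symm
  have := h {F | ∃ v ∈ verts F, v.1 = true} (by
    intro x y hx hxy
    obtain ⟨v, hv⟩ := (hne x).1 hx
    constructor
    · rintro ⟨w, hw, hwt⟩
      exact ⟨w, hxy hw, hwt⟩
    · rintro ⟨w, hw, hwt⟩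
      obtain ⟨b, hb⟩ := verts_mem y
      exact ⟨v, hv, (hb v (hxy hv)).trans ((hb w hw).symm.trans hwt)⟩)
    (ofVerts _ _ (hmem true)) trivial (ofVerts _ _ (hmem false)) trivial
    ((hne _).2 (Finset.singleton_nonempty _)) ((hne _).2 (Finset.singleton_nonempty _))
    ⟨_, Finset.mem_singleton_self _, rfl⟩
  obtain ⟨w, hw, hwt⟩ := this
  rw [verts_ofVerts, Finset.mem_singleton] at hw
  rw [hw] at hwt
  exact Bool.false_ne_true hwt

end SimplicialCW

theorem mainTheorem4 (d t : ℕ) (ht : 1 ≤ t) (htd : t ≤ d) :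
    (∀ P : SimplicialCW, P.IsPseudomanifold d → P.IsTConstructible d t → P.IsTLC d t) ∧
    (∀ P : SimplicialCW, P.IsTLC d t → P.IsPseudomanifold d) ∧
    (t + 2 ≤ d →
      (∃ P : SimplicialCW, P.IsSimplicialComplex ∧ P.IsPseudomanifold d ∧ P.IsTLC d t ∧
        ¬ P.IsTConstructible d t) ∧
      (∃ P : SimplicialCW, P.IsSimplicialComplex ∧ P.IsPseudomanifold d ∧ ¬ P.IsTLC d t)) := by
  open SimplicialCW in
  refine ⟨fun P hP h => (h.isWeaklyConstructible ht).isTLC hP, fun P hP => hP.1, fun hd => ⟨?_, ?_⟩⟩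
  · obtain ⟨V, _, _, C, hpure, hpm, hbuild, hcoh⟩ := exists_family d (by omega)
    have hP := hpm.isPseudomanifold hpure
    have hw := hbuild.isWeaklyConstructible ht hpure.1 le_rfl
    rw [restrict_self] at hw
    refine ⟨ofFinsets C hpure.1, isSimplicialComplex_ofFinsets, hP, hw.isTLC hP, fun h => ?_⟩
    exact hcoh.not_isAcyclicAt hpure.1 (h.isAcyclicAt (by omega) (by omega))
  · exact ⟨ofFinsets (twoSimplices d) (isPureFamily_twoSimplices d).1,
      isSimplicialComplex_ofFinsets,
      (isPseudomanifoldFamily_twoSimplices (by omega)).isPseudomanifold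
        (isPureFamily_twoSimplices d),
      fun h => not_hasTLocalConstruction_of_not_isConnectedPoset (by omega)
        (not_isConnectedPoset_twoSimplices d) h.2⟩
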